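/- Let $q$ be a prime power, $n\ge 1$, and let $V=\mathbb F_q^n$ be the standard module of $GL_n(q)$, with symmetric algebra $S^\bullet(V)$ and exterior algebra $\wedge^\bullet(V)$. Let $I=(n_1,\dots,n_\ell)$ be a composition of $n$ (all $n_i\ge 1$, $\sum_i n_i=n$), put $m_0=0$ and $m_i=n_1+\dots+n_i$ for $1\le i\le \ell$, and let $P_I\le GL_n(q)$ be the standard parabolic subgroup of invertible block upper triangular matrices with diagonal blocks of sizes $n_1,\dots,n_\ell$. Then the bi-graded Hilbert series $$H\big((S^\bullet(V)\otimes\wedge^\bullet(V))^{P_I};t,s\big)=\sum_{i,j\ge 0}t^i s^j\,\dim_{\mathbb F_q}\big(S^i(V)\otimes\wedge^j(V)\big)^{P_I}$$ is equal to $$\frac{1-t^{q^{m_1}-1}+\sum_{i=1}^{\ell-1}\big(t^{q^{m_i}-1}-t^{q^{m_{i+1}}-1}\big)\prod_{j=1}^{m_i}\big(1+st^{-q^{j-1}}\big)+t^{q^n-1}\prod_{j=1}^{n}\big(1+st^{-q^{j-1}}\big)}{\prod_{i=1}^{\ell}\prod_{j=1}^{n_i}\big(1-t^{q^{m_i}-q^{m_i-j}}\big)}.$$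 -/

import Mathlib

open scoped TensorProduct

noncomputable section

namespace DicksonMui

/-- The standard parabolic subgroup `P_I` of `GL_n(F)` attached to a composition `I` of `n`:
the invertible block upper triangular matrices, with diagonal blocks of sizes
`n_1, …, n_ℓ` (the map `I.index` sends a position to the number of its block). -/
def parabolic (F : Type*) [Field F] {n : ℕ} (I : Composition n) :
    Subgroup (GL (Fin n) F) where
  carrier := {g | Matrix.BlockTriangular (g : Matrix (Fin n) (Fin n) F) I.index}
  mul_mem' {g h} hg hh := by
    simp only [Set.mem_ofPred_eq, Matrix.GeneralLinearGroup.coe_mul] at *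
    exact Matrix.BlockTriangular.mul hg hh
  one_mem' := by
    simpa using Matrix.blockTriangular_one
  inv_mem' {g} hg := by
    have hi : Invertible (g : Matrix (Fin n) (Fin n) F) := g.invertible
    simp only [Set.mem_ofPred_eq, Matrix.coe_units_inv] at *
    exact Matrix.blockTriangular_inv_of_blockTriangular hg

/-- `GL_n(F)` acting on `S(V) = F[x_1, …, x_n]`, `V = F^n` with standard basis `x_1, …, x_n`,
by the algebra automorphisms `x_j ↦ g x_j = ∑ i, g_{ij} x_i`. -/
def symRep (F : Type*) [Field F] (n : ℕ) :
    Representation F (GL (Fin n) F) (MvPolynomial (Fin n) F) where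
  toFun g := (MvPolynomial.aeval
    (fun j => ∑ i, MvPolynomial.C (g i j) * MvPolynomial.X i)).toLinearMap
  map_one' := by
    rw [Module.End.one_eq_id, ← AlgHom.toLinearMap_id]
    congr 1
    ext j : 1
    simp [Matrix.one_apply]
  map_mul' g h := by
    rw [Module.End.mul_eq_comp, ← AlgHom.comp_toLinearMap]
    congr 1
    ext j : 1
    simp only [MvPolynomial.aeval_X, AlgHom.comp_apply, map_sum, map_mul,
      MvPolynomial.algHom_C, Matrix.GeneralLinearGroup.coe_mul, Matrix.mul_apply,
      Finset.sum_mul, Finset.mul_sum, MvPolynomial.algebraMap_eq]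
    rw [Finset.sum_comm]
    refine Finset.sum_congr rfl fun i _ => Finset.sum_congr rfl fun k _ => ?_
    ring

/-- `GL_n(F)` acting on the exterior algebra of `V = F^n` by the algebra automorphisms
induced by `v ↦ g v`. -/
def extRep (F : Type*) [Field F] (n : ℕ) :
    Representation F (GL (Fin n) F) (ExteriorAlgebra F (Fin n → F)) where
  toFun g := (ExteriorAlgebra.map
    (Matrix.mulVecLin (g : Matrix (Fin n) (Fin n) F))).toLinearMap
  map_one' := by
    simp [Module.End.one_eq_id]
  map_mul' g h := by
    rw [Module.End.mul_eq_comp, ← AlgHom.comp_toLinearMap, ExteriorAlgebra.map_comp_map,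
      ← Matrix.mulVecLin_mul, Matrix.GeneralLinearGroup.coe_mul]

/-- The diagonal action of `GL_n(F)` on `S(V) ⊗ ∧(V)`. -/
def symExtRep (F : Type*) [Field F] (n : ℕ) :
    Representation F (GL (Fin n) F)
      (MvPolynomial (Fin n) F ⊗[F] ExteriorAlgebra F (Fin n → F)) :=
  (symRep F n).tprod (extRep F n)

/-- The component `S^i(V) ⊗ ∧^j(V)` of `S(V) ⊗ ∧(V)`. -/
def bidegree (F : Type*) [Field F] (n i j : ℕ) :
    Submodule F (MvPolynomial (Fin n) F ⊗[F] ExteriorAlgebra F (Fin n → F)) :=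
  LinearMap.range (TensorProduct.map
    (MvPolynomial.homogeneousSubmodule (Fin n) F i).subtype
    (⋀[F]^j (Fin n → F)).subtype)

/-- The subspace `(S(V) ⊗ ∧(V))^{P_I}` of `P_I`-invariants. -/
def parabolicInvariants (F : Type*) [Field F] {n : ℕ} (I : Composition n) :
    Submodule F (MvPolynomial (Fin n) F ⊗[F] ExteriorAlgebra F (Fin n → F)) :=
  Representation.invariants ((symExtRep F n).comp (parabolic F I).subtype)

/-- The field `ℚ((t))((s))`, in which identities of formal series in `t`, `s` are stated; it
contains the ring of formal power series in `t` and `s`, the field of rational functions in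
`t` and `s`, and in particular the inverse of `t`. -/
abbrev SeriesField : Type := LaurentSeries (LaurentSeries ℚ)

/-- The variable `t`. -/
def tVar : SeriesField := HahnSeries.C (HahnSeries.single (1 : ℤ) (1 : ℚ))

/-- The variable `s`. -/
def sVar : SeriesField := HahnSeries.single (1 : ℤ) (1 : LaurentSeries ℚ)

/-- The formal power series `∑ i j, a i j t^i s^j`. -/
def doubleSeries (a : ℕ → ℕ → ℚ) : SeriesField :=
  HahnSeries.ofPowerSeries ℤ (LaurentSeries ℚ)
    (PowerSeries.mk fun j => HahnSeries.ofPowerSeries ℤ ℚ (PowerSeries.mk fun i => a i j))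

/-- The bi-graded Hilbert series of `(S(V) ⊗ ∧(V))^{P_I}`:
`∑ i j, t^i s^j dim (S^i(V) ⊗ ∧^j(V))^{P_I}`. -/
def hilbertSeries (F : Type*) [Field F] {n : ℕ} (I : Composition n) : SeriesField :=
  doubleSeries fun i j =>
    (Module.finrank F ↥(parabolicInvariants F I ⊓ bidegree F n i j) : ℚ)

/-- The product `∏_{j=1}^{m} (1 + s t^{-q^{j-1}})`. -/
def mixedProd (q m : ℕ) : SeriesField :=
  ∏ j ∈ Finset.Icc 1 m, (1 + sVar * tVar ^ (-((q ^ (j - 1) : ℕ) : ℤ)))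

end DicksonMui

end

/-!
The proof exhibits the invariants of `P = P_I` in `S(V) ⊗ ∧(V)` as a free module over the ring
`S(V)^P` of polynomial invariants, with a bihomogeneous basis indexed by the subsets `B` of
`{0, …, n - 1}`, and determines the Hilbert series of `S(V)^P`. Below, the variables are numbered
from `0`, as in `Fin n`.

**Polynomial invariants.** For the flag spaces `V_k = ⟨x_0, …, x_{k-1}⟩` the polynomial
`∏ (X - v)`, `v ∈ V_k`, is additive (`flagPoly`, `flagMap`), and its coefficients are invariant
when `k` is the end of a block. Adjoin the variables `x_0, x_1, …` to `S(V)^P` one at a time. If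
`e` is the end of the block of `x_k`, then `x_k` is a root of the quotient of `∏_{V_e} (X - v)` by
`∏_{V_k} (X - v)`, and the elements of `P` that fix the earlier variables move `x_k` to all
`q^e - q^k` roots of it. So each step is free on the powers of `x_k` below `q^e - q^k`. As the last
ring is `S(V)`, the series of `S(V)^P` is the inverse of `∏_k (1 - t^{q^e - q^k})`
(`gradedSeries_symInvariants_mul_prod`).

**Forms.** An element of `S(V) ⊗ ∧^k(V)` is an alternating function of `k` rows in `S(V)^n`
(`formEval`, `formAlt`). Certain powers of `flagMap`, applied to the variables, give rows
`dualRow r` of degree `q^r` that commute with `P` and have nonzero determinant. Hence a form is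
determined by its values on the sets `B` of these rows, and it is invariant if and only if the
values are. There are forms `basisForm B` whose value on the rows `B'` is
`mooreProd m ^ (q - 1)` if `B' = B`, and `0` otherwise; here `m` is the end of the last block that
meets `B`, and `mooreProd m` is the product over `k < m` of the products `∏ (x_k - v)`, `v ∈ V_k`.

**Divisibility.** What remains is that the value of an invariant form on the rows `B` is divisible
by `mooreProd m ^ (q - 1)` (`mooreProd_pow_dvd_formEval_dualRows`). As `P` acts and the linear
factors are coprime, it suffices to treat `x_p ^ (q - 1)` for `p` the first position of a block
that does not come after the last block that meets `B`. Replace the coordinate functional of `x_p`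
by the row `∑_{j ≥ p} x_j e_j`. The resulting rows commute with the transvections
`x_j ↦ x_j + c x_p`, `j > p`, so the values on them are modulo `x_p` polynomials in the `x_j ^ q`,
`j > p`, and the other variables. Between these values there are relations `f = ∑_{j > p} x_j h_j`
modulo `x_p`, which are only possible if `x_p` divides all terms. The power `q - 1` then comes from
the dilations of `x_p`.

**Summation.** So the Hilbert series is that of `S(V)^P` times the sum of
`s^{|B|} t^{q^m - 1 - ∑_{b ∈ B} q^b}` over all `B`, and summation by parts over the blocks turns
this sum into the numerator (`numerator_eq_sum`).
-/


noncomputable section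

namespace DicksonMui

/-! ### The action on polynomials and linear forms -/

section Action

variable {F : Type*} [Field F] {n : ℕ}

/-- The algebra endomorphism of `F[x_1, …, x_n]` by which `g` acts. -/
def actHom (g : GL (Fin n) F) : MvPolynomial (Fin n) F →ₐ[F] MvPolynomial (Fin n) F :=
  MvPolynomial.aeval fun j => ∑ i, MvPolynomial.C (g i j) * MvPolynomial.X i

/-- The linear form `∑ j, v_j x_j` with coefficient vector `v`. -/
def lin : (Fin n → F) →ₗ[F] MvPolynomial (Fin n) F :=
  Fintype.linearCombination F (fun j => MvPolynomial.X j)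

lemma lin_apply (v : Fin n → F) :
    lin v = ∑ j, MvPolynomial.C (v j) * MvPolynomial.X j := by
  simp [lin, Fintype.linearCombination_apply, MvPolynomial.smul_eq_C_mul]

lemma lin_single (j : Fin n) : lin (Pi.single j (1 : F)) = MvPolynomial.X j := by
  simp [lin]

lemma coeff_lin (v : Fin n → F) (j : Fin n) :
    (lin v).coeff (Finsupp.single j 1) = v j := by
  classical
  simp [lin_apply, MvPolynomial.coeff_sum, MvPolynomial.coeff_X, Finsupp.single_left_inj]

lemma lin_injective : Function.Injective (lin : (Fin n → F) → MvPolynomial (Fin n) F) := by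
  intro v w h
  ext j
  rw [← coeff_lin v j, h, coeff_lin]

lemma isHomogeneous_lin (v : Fin n → F) : (lin v).IsHomogeneous 1 := by
  rw [lin_apply]
  exact MvPolynomial.IsHomogeneous.sum _ _ _ fun j _ => MvPolynomial.isHomogeneous_C_mul_X _ _

lemma symRep_apply (g : GL (Fin n) F) (f : MvPolynomial (Fin n) F) :
    symRep F n g f = actHom g f := rfl

lemma actHom_X (g : GL (Fin n) F) (j : Fin n) :
    actHom g (MvPolynomial.X j) = lin fun i => g i j := by
  simp [actHom, lin_apply]

lemma actHom_lin (g : GL (Fin n) F) (v : Fin n → F) :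
    actHom g (lin v) = lin ((g : Matrix (Fin n) (Fin n) F).mulVec v) := by
  have : (actHom g).toLinearMap ∘ₗ lin = lin ∘ₗ Matrix.mulVecLin (g : Matrix (Fin n) (Fin n) F) := by
    refine LinearMap.pi_ext' fun j => LinearMap.ext_ring ?_
    simp only [LinearMap.comp_apply, LinearMap.single_apply, lin_single, AlgHom.toLinearMap_apply,
      actHom_X, Matrix.mulVecLin_apply, Matrix.mulVec_single_one]
    rfl
  exact LinearMap.congr_fun this v

lemma actHom_mul (g h : GL (Fin n) F) (f : MvPolynomial (Fin n) F) :
    actHom (g * h) f = actHom g (actHom h f) := by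
  simp only [← symRep_apply, map_mul, Module.End.mul_apply]

lemma isHomogeneous_actHom (g : GL (Fin n) F) {f : MvPolynomial (Fin n) F} {d : ℕ}
    (hf : f.IsHomogeneous d) : (actHom g f).IsHomogeneous d := by
  have h := hf.aeval (fun j => ∑ i, MvPolynomial.C (g i j) * MvPolynomial.X i) (n := 1)
    fun j => MvPolynomial.IsHomogeneous.sum _ _ _ fun i _ => MvPolynomial.isHomogeneous_C_mul_X _ _
  rwa [one_mul] at h

end Action

/-! ### Blocks of a composition and elements of the parabolic subgroup -/

section Blocks

variable {n : ℕ} (I : Composition n)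

/-- The number of positions that precede the block of `k`. -/
def blockStart (k : Fin n) : ℕ := I.sizeUpTo (I.index k)

/-- The number of positions up to the end of the block of `k`. -/
def blockEnd (k : Fin n) : ℕ := I.sizeUpTo (I.index k + 1)

lemma blockStart_le (k : Fin n) : blockStart I k ≤ k := I.sizeUpTo_index_le k

lemma lt_blockEnd (k : Fin n) : (k : ℕ) < blockEnd I k := by
  simpa using! I.lt_sizeUpTo_index_succ k

lemma blockEnd_le (k : Fin n) : blockEnd I k ≤ n := I.sizeUpTo_le _

lemma index_lt_iff {k r : Fin n} : I.index k < I.index r ↔ blockEnd I k ≤ r := by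
  constructor
  · intro h
    exact (I.monotone_sizeUpTo (Nat.succ_le_of_lt h)).trans (blockStart_le I r)
  · intro h
    by_contra hc
    have h1 : blockEnd I r ≤ blockEnd I k :=
      I.monotone_sizeUpTo (Nat.succ_le_succ (not_lt.mp hc))
    have h2 := lt_blockEnd I r
    omega

lemma blockEnd_le_iff {k r : Fin n} : blockEnd I k ≤ r ↔ blockEnd I k ≤ blockStart I r :=
  ⟨fun h => I.monotone_sizeUpTo (Nat.succ_le_of_lt ((index_lt_iff I).2 h)),
    fun h => h.trans (blockStart_le I r)⟩

lemma blockStart_mono {k r : Fin n} (h : (k : ℕ) < blockEnd I r) :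
    blockStart I k ≤ blockStart I r := by
  apply I.monotone_sizeUpTo
  rw [← Fin.le_def]
  by_contra hc
  have := (index_lt_iff I).1 (not_le.mp hc)
  omega

lemma blockEnd_mono {k r : Fin n} (h : (k : ℕ) < blockEnd I r) :
    blockEnd I k ≤ blockEnd I r := by
  apply I.monotone_sizeUpTo
  have : I.index k ≤ I.index r := by
    by_contra hc
    have := (index_lt_iff I).1 (not_le.mp hc)
    omega
  exact Nat.succ_le_succ this

variable {F : Type*} [Field F]

lemma mem_parabolic_iff {I : Composition n} {g : GL (Fin n) F} :
    g ∈ parabolic F I ↔ ∀ r k : Fin n, blockEnd I k ≤ r → g r k = 0 := by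
  simp only [← index_lt_iff]
  exact Iff.rfl

/-- The element of `GL_n(F)` that sends `x_k` to `∑ j, v_j x_j` and fixes the other variables. -/
def replaceCol (k : Fin n) (v : Fin n → F) (hv : v k ≠ 0) : GL (Fin n) F :=
  Matrix.GeneralLinearGroup.mkOfDetNeZero ((1 : Matrix (Fin n) (Fin n) F).updateCol k v) (by
    rw [← Matrix.cramer_apply, Matrix.cramer_one]
    exact hv)

lemma coe_replaceCol (k : Fin n) (v : Fin n → F) (hv : v k ≠ 0) :
    (replaceCol k v hv : Matrix (Fin n) (Fin n) F) = (1 : Matrix _ _ F).updateCol k v := rfl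

lemma actHom_replaceCol_self (k : Fin n) (v : Fin n → F) (hv : v k ≠ 0) :
    actHom (replaceCol k v hv) (MvPolynomial.X k) = lin v := by
  simp [actHom_X, coe_replaceCol]

lemma actHom_replaceCol_of_ne {k j : Fin n} (v : Fin n → F) (hv : v k ≠ 0) (hj : j ≠ k) :
    actHom (replaceCol k v hv) (MvPolynomial.X j) = MvPolynomial.X j := by
  rw [actHom_X, ← lin_single]
  congr 1
  ext i
  simp [coe_replaceCol, Matrix.updateCol_ne hj, Matrix.one_apply, Pi.single_apply]

lemma replaceCol_mem_parabolic {I : Composition n} {k : Fin n} {v : Fin n → F} {hv : v k ≠ 0}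
    (h : ∀ j : Fin n, blockEnd I k ≤ j → v j = 0) :
    replaceCol k v hv ∈ parabolic F I := by
  rw [mem_parabolic_iff]
  intro r j hrj
  rw [coe_replaceCol]
  by_cases hj : j = k
  · subst hj
    simpa using h r hrj
  · have hne : r ≠ j := by
      rintro rfl
      have := lt_blockEnd I r
      omega
    rw [Matrix.updateCol_ne hj, Matrix.one_apply_ne hne]

/-- The elements of the parabolic subgroup that fix the variables before `x_k` act transitively
on the linear forms of the flag step of the block of `x_k` that involve a variable from `x_k`
on. -/
lemma exists_parabolic_actHom_X {I : Composition n} (k : Fin n) (v : Fin n → F)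
    (h : ∀ j : Fin n, blockEnd I k ≤ j → v j = 0) (hv : ∃ j : Fin n, k ≤ j ∧ v j ≠ 0) :
    ∃ g ∈ parabolic F I, actHom g (MvPolynomial.X k) = lin v ∧
      ∀ j < k, actHom g (MvPolynomial.X j) = MvPolynomial.X j := by
  by_cases hk : v k = 0
  · obtain ⟨j, hkj, hj⟩ := hv
    have hjk : j ≠ k := by rintro rfl; exact hj hk
    have hjlt : (j : ℕ) < blockEnd I k := by
      by_contra hc
      exact hj (h j (not_lt.mp hc))
    -- A single column replacement needs `v_k ≠ 0`; here `x_k ↦ x_j + x_k` is followed by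
    -- `x_j ↦ v - x_k`.
    have h1 : (Pi.single j 1 + Pi.single k 1 : Fin n → F) k ≠ 0 := by simp [hjk.symm]
    have h2 : (v - Pi.single k 1 : Fin n → F) j ≠ 0 := by simpa [hjk] using hj
    refine ⟨replaceCol j (v - Pi.single k 1) h2 * replaceCol k _ h1,
      mul_mem (replaceCol_mem_parabolic ?_) (replaceCol_mem_parabolic ?_), ?_, ?_⟩
    · intro i hi
      have hik : i ≠ k := by
        rintro rfl
        have := lt_blockEnd I j
        have : (i : ℕ) ≤ j := hkj
        omega
      have h3 : blockEnd I k ≤ blockEnd I j := blockEnd_mono I ((show (k:ℕ) ≤ j from hkj).trans_lt (lt_blockEnd I j))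
      simp [hik, h i (h3.trans hi)]
    · intro i hi
      have hik : i ≠ k := by rintro rfl; have := lt_blockEnd I i; omega
      have hij : i ≠ j := by rintro rfl; omega
      simp [hik, hij]
    · rw [actHom_mul, actHom_replaceCol_self, map_add, map_add, lin_single, lin_single,
        actHom_replaceCol_self, actHom_replaceCol_of_ne _ _ hjk.symm, map_sub, lin_single,
        sub_add_cancel]
    · intro i hi
      have hij : i ≠ j := (hi.trans_le hkj).ne
      rw [actHom_mul, actHom_replaceCol_of_ne _ _ hi.ne, actHom_replaceCol_of_ne _ _ hij]
  · exact ⟨replaceCol k v hk, replaceCol_mem_parabolic h, actHom_replaceCol_self k v hk,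
      fun j hj => actHom_replaceCol_of_ne v hk hj.ne⟩

end Blocks

/-! ### The additive polynomials of the standard flag -/

section Flag

variable {F : Type*} [Field F] [Fintype F] {n : ℕ}

local notation "q" => Fintype.card F

variable (F n) in
/-- The coefficient vectors of the linear forms in the first `k` variables. -/
def flagSpace (k : ℕ) : Finset (Fin n → F) := by
  classical
  exact Fintype.piFinset fun j => if (j : ℕ) < k then Finset.univ else {0}

lemma mem_flagSpace {k : ℕ} {v : Fin n → F} :
    v ∈ flagSpace F n k ↔ ∀ j : Fin n, k ≤ j → v j = 0 := by
  classical
  simp only [flagSpace, Fintype.mem_piFinset]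
  refine forall_congr' fun j => ?_
  split_ifs with h
  · simp [h]
  · simp [not_lt.mp h]

lemma card_flagSpace {k : ℕ} (hk : k ≤ n) : (flagSpace F n k).card = q ^ k := by
  classical
  have h1 : ∀ j : Fin n, (if (j : ℕ) < k then (Finset.univ : Finset F) else {0}).card
      = if (j : ℕ) < k then q else 1 := by
    intro j; split_ifs <;> simp
  simp only [flagSpace, Fintype.card_piFinset, h1, Finset.prod_ite, Finset.prod_const,
    one_pow, mul_one]
  congr 1
  have h2 : (Finset.univ.filter fun j : Fin n => (j : ℕ) < k)
      = (Finset.univ : Finset (Fin k)).map (Fin.castLEEmb hk) := by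
    ext j
    simp only [Finset.mem_filter, Finset.mem_univ, true_and, Finset.mem_map]
    exact ⟨fun h => ⟨⟨j, h⟩, rfl⟩, by rintro ⟨i, rfl⟩; exact i.2⟩
  rw [h2, Finset.card_map, Finset.card_univ, Fintype.card_fin]

variable (F n) in
/-- The variable with index `k`, and `0` when there is none. -/
def flagVar (k : ℕ) : MvPolynomial (Fin n) F :=
  if h : k < n then MvPolynomial.X ⟨k, h⟩ else 0

omit [Fintype F] in
lemma flagVar_val (k : Fin n) : flagVar F n k = MvPolynomial.X k := by
  simp [flagVar]

omit [Fintype F] in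
lemma isHomogeneous_flagVar (k : ℕ) : (flagVar F n k).IsHomogeneous 1 := by
  unfold flagVar
  split_ifs
  · exact MvPolynomial.isHomogeneous_X _ _
  · exact MvPolynomial.isHomogeneous_zero _ _ _

variable (F n) in
/-- The `F`-linear operator `y ↦ ∏ (y - v)`, the product being over the linear forms `v` in the
first `k` variables (see `flagPoly_eq_prod`). It is defined by the recursion that adjoins one
variable at a time. -/
def flagMap : ℕ → (MvPolynomial (Fin n) F →ₗ[F] MvPolynomial (Fin n) F)
  | 0 => LinearMap.id
  | k + 1 => (FiniteField.frobeniusAlgHom F _).toLinearMap ∘ₗ flagMap k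
      - LinearMap.mulLeft F (flagMap k (flagVar F n k) ^ (q - 1)) ∘ₗ flagMap k

lemma flagMap_zero (y : MvPolynomial (Fin n) F) : flagMap F n 0 y = y := rfl

lemma flagMap_succ (k : ℕ) (y : MvPolynomial (Fin n) F) :
    flagMap F n (k + 1) y = flagMap F n k y ^ q
      - flagMap F n k (flagVar F n k) ^ (q - 1) * flagMap F n k y := by
  simp [flagMap, FiniteField.coe_frobeniusAlgHom]

variable (F n) in
/-- The polynomial in one variable over `F[x_1, …, x_n]` that induces `flagMap`. -/
def flagPoly : ℕ → Polynomial (MvPolynomial (Fin n) F)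
  | 0 => Polynomial.X
  | k + 1 => flagPoly k ^ q
      - Polynomial.C (flagMap F n k (flagVar F n k) ^ (q - 1)) * flagPoly k

lemma eval_flagPoly (k : ℕ) (y : MvPolynomial (Fin n) F) :
    (flagPoly F n k).eval y = flagMap F n k y := by
  induction k with
  | zero => simp [flagPoly, flagMap_zero]
  | succ k ih => simp [flagPoly, flagMap_succ, ih]

lemma one_lt_q : 1 < q := Fintype.one_lt_card

lemma flagPoly_monic_natDegree (k : ℕ) :
    (flagPoly F n k).Monic ∧ (flagPoly F n k).natDegree = q ^ k := by
  induction k with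
  | zero => simp [flagPoly, Polynomial.monic_X]
  | succ k ih =>
    obtain ⟨hm, hd⟩ := ih
    have hlt : (Polynomial.C (flagMap F n k (flagVar F n k) ^ (q - 1)) * flagPoly F n k).natDegree
        < (flagPoly F n k ^ q).natDegree := by
      refine (Polynomial.natDegree_C_mul_le _ _).trans_lt ?_
      rw [hm.natDegree_pow, hd]
      exact lt_mul_of_one_lt_left (pow_pos Fintype.card_pos _) one_lt_q
    refine ⟨(hm.pow q).sub_of_left (Polynomial.degree_lt_degree hlt), ?_⟩
    rw [flagPoly, Polynomial.natDegree_sub_eq_left_of_natDegree_lt hlt, hm.natDegree_pow, hd,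
      pow_succ']

lemma X_dvd_flagPoly (k : ℕ) : Polynomial.X ∣ flagPoly F n k := by
  induction k with
  | zero => exact dvd_rfl
  | succ k ih =>
    exact dvd_sub (dvd_pow ih (Fintype.card_ne_zero)) (ih.mul_left _)

lemma flagPoly_dvd_of_le {k m : ℕ} (h : k ≤ m) : flagPoly F n k ∣ flagPoly F n m := by
  induction m, h using Nat.le_induction with
  | base => exact dvd_rfl
  | succ m _ ih =>
    exact dvd_sub (dvd_pow ih Fintype.card_ne_zero) (ih.mul_left _)

lemma dvd_flagMap (k : ℕ) (y : MvPolynomial (Fin n) F) : y ∣ flagMap F n k y := by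
  rw [← eval_flagPoly]
  simpa using Polynomial.eval_dvd (x := y) (X_dvd_flagPoly (F := F) (n := n) k)

lemma flagMap_lin_eq_zero {k : ℕ} {v : Fin n → F} (hv : v ∈ flagSpace F n k) :
    flagMap F n k (lin v) = 0 := by
  induction k generalizing v with
  | zero =>
    have : v = 0 := by
      ext j
      exact mem_flagSpace.1 hv j (Nat.zero_le _)
    simp [this]
  | succ k ih =>
    rw [mem_flagSpace] at hv
    by_cases hk : k < n
    · have h0 : v - Pi.single ⟨k, hk⟩ (v ⟨k, hk⟩) ∈ flagSpace F n k := by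
        rw [mem_flagSpace]
        intro j hj
        by_cases hjk : j = ⟨k, hk⟩
        · simp [hjk]
        · have : k + 1 ≤ j := by
            have : (j : ℕ) ≠ k := fun h => hjk (Fin.ext h)
            omega
          simp [hjk, hv j this]
      have h1 : flagMap F n k (lin v) = v ⟨k, hk⟩ • flagMap F n k (flagVar F n k) := by
        have h2 : lin v = lin (v - Pi.single ⟨k, hk⟩ (v ⟨k, hk⟩))
            + v ⟨k, hk⟩ • flagVar F n k := by
          have h3 : (Pi.single ⟨k, hk⟩ (v ⟨k, hk⟩) : Fin n → F)
              = v ⟨k, hk⟩ • Pi.single ⟨k, hk⟩ 1 := by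
            rw [← Pi.single_smul, smul_eq_mul, mul_one]
          rw [map_sub, h3, map_smul, lin_single, flagVar, dif_pos hk, sub_add_cancel]
        rw [h2, map_add, ih h0, zero_add, map_smul]
      rw [flagMap_succ, h1, smul_pow, FiniteField.pow_card, mul_smul_comm,
        pow_sub_one_mul Fintype.card_ne_zero, sub_self]
    · rw [flagMap_succ, ih, zero_pow Fintype.card_ne_zero, mul_zero, sub_zero]
      rw [mem_flagSpace]
      intro j hj
      have := j.2
      omega

lemma flagMap_X_eq_zero {k : ℕ} {j : Fin n} (h : (j : ℕ) < k) :
    flagMap F n k (MvPolynomial.X j) = 0 := by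
  rw [← lin_single]
  refine flagMap_lin_eq_zero (mem_flagSpace.2 fun i hi => ?_)
  have : i ≠ j := by rintro rfl; omega
  simp [this]

/-- A monic polynomial over a domain is the product of the linear factors of any set of roots
that has as many elements as the degree. -/
lemma eq_prod_X_sub_C_of_roots {R ι : Type*} [CommRing R] [IsDomain R] {p : Polynomial R}
    (hp : p.Monic) {s : Finset ι} {f : ι → R} (hf : Set.InjOn f s) (hr : ∀ i ∈ s, p.eval (f i) = 0)
    (hd : p.natDegree = s.card) : p = ∏ i ∈ s, (Polynomial.X - Polynomial.C (f i)) := by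
  have hle : s.val.map f ≤ p.roots := by
    refine (Multiset.le_iff_subset (Multiset.Nodup.map_on hf s.nodup)).2 fun a ha => ?_
    obtain ⟨i, hi, rfl⟩ := Multiset.mem_map.1 ha
    exact (Polynomial.mem_roots hp.ne_zero).2 (hr i hi)
  have hdvd := (Multiset.prod_X_sub_C_dvd_iff_le_roots hp.ne_zero _).2 hle
  rw [Multiset.map_map] at hdvd
  refine Polynomial.eq_of_monic_of_dvd_of_natDegree_le
    (Polynomial.monic_prod_of_monic _ _ fun i _ => Polynomial.monic_X_sub_C _) hp hdvd ?_
  rw [Polynomial.natDegree_prod_of_monic _ _ fun i _ => Polynomial.monic_X_sub_C _, hd]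
  simp

lemma flagPoly_eq_prod {k : ℕ} (hk : k ≤ n) :
    flagPoly F n k = ∏ v ∈ flagSpace F n k, (Polynomial.X - Polynomial.C (lin v)) := by
  refine eq_prod_X_sub_C_of_roots (flagPoly_monic_natDegree k).1 lin_injective.injOn
    (fun v hv => ?_) ?_
  · rw [eval_flagPoly, flagMap_lin_eq_zero hv]
  · rw [(flagPoly_monic_natDegree k).2, card_flagSpace hk]

lemma flagMap_X_eq_prod (k : Fin n) :
    flagMap F n k (MvPolynomial.X k) =
      ∏ v ∈ flagSpace F n k, lin (Pi.single k (1 : F) - v) := by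
  rw [← eval_flagPoly, flagPoly_eq_prod k.2.le, Polynomial.eval_prod]
  simp [lin_single]

lemma flagMap_X_ne_zero (k : Fin n) : flagMap F n k (MvPolynomial.X k) ≠ 0 := by
  rw [flagMap_X_eq_prod, Finset.prod_ne_zero_iff]
  intro v hv h
  have h1 := lin_injective (h.trans (map_zero lin).symm)
  have h2 := congrFun h1 k
  rw [Pi.sub_apply, mem_flagSpace.1 hv k le_rfl] at h2
  simp at h2

lemma isHomogeneous_flagMap (k : ℕ) {y : MvPolynomial (Fin n) F} (hy : y.IsHomogeneous 1) :
    (flagMap F n k y).IsHomogeneous (q ^ k) := by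
  induction k generalizing y with
  | zero => simpa [flagMap_zero] using hy
  | succ k ih =>
    rw [flagMap_succ]
    refine MvPolynomial.IsHomogeneous.sub (by simpa [pow_succ] using (ih hy).pow q) ?_
    have h := ((ih (isHomogeneous_flagVar k)).pow (q - 1)).mul (ih hy)
    convert! h using 1
    obtain ⟨c, hc⟩ : ∃ c, q = c + 1 := ⟨q - 1, (Nat.sub_add_cancel one_lt_q.le).symm⟩
    rw [hc]
    simp [pow_succ, mul_add]

/-! ### Invariance at block boundaries -/

/-- `m` is a partial sum of the composition. -/
def IsBlockBoundary (I : Composition n) (m : ℕ) : Prop :=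
  m ≤ n ∧ ∀ k : Fin n, (k : ℕ) < m → blockEnd I k ≤ m

lemma isBlockBoundary_blockEnd (I : Composition n) (k : Fin n) :
    IsBlockBoundary I (blockEnd I k) :=
  ⟨blockEnd_le I k, fun _ h => blockEnd_mono I h⟩

lemma isBlockBoundary_blockStart (I : Composition n) (k : Fin n) :
    IsBlockBoundary I (blockStart I k) := by
  refine ⟨(blockStart_le I k).trans k.2.le, fun j h => ?_⟩
  by_contra hc
  have h1 := blockStart_mono I (k := k) (r := j) (by
    by_contra h2
    exact hc ((blockEnd_le_iff I).1 (not_lt.mp h2)))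
  have := blockStart_le I j
  omega

lemma mulVec_mem_flagSpace {I : Composition n} {m : ℕ} (hm : IsBlockBoundary I m)
    {g : GL (Fin n) F} (hg : g ∈ parabolic F I) {v : Fin n → F} (hv : v ∈ flagSpace F n m) :
    (g : Matrix (Fin n) (Fin n) F).mulVec v ∈ flagSpace F n m := by
  rw [mem_flagSpace] at hv ⊢
  intro i hi
  rw [Matrix.mulVec, dotProduct]
  refine Finset.sum_eq_zero fun j _ => ?_
  by_cases hj : m ≤ j
  · rw [hv j hj, mul_zero]
  · rw [mem_parabolic_iff.1 hg i j ((hm.2 j (not_le.mp hj)).trans hi), zero_mul]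

lemma map_flagPoly {I : Composition n} {m : ℕ} (hm : IsBlockBoundary I m)
    {g : GL (Fin n) F} (hg : g ∈ parabolic F I) :
    (flagPoly F n m).map (actHom g).toRingHom = flagPoly F n m := by
  rw [flagPoly_eq_prod hm.1, Polynomial.map_prod]
  refine Finset.prod_nbij' (fun v => (g : Matrix (Fin n) (Fin n) F).mulVec v)
    (fun v => ((g⁻¹ : GL (Fin n) F) : Matrix (Fin n) (Fin n) F).mulVec v)
    (fun v hv => mulVec_mem_flagSpace hm hg hv)
    (fun v hv => mulVec_mem_flagSpace hm (inv_mem hg) hv) ?_ ?_ ?_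
  · intro v _
    rw [Matrix.mulVec_mulVec, ← Matrix.GeneralLinearGroup.coe_mul, inv_mul_cancel]
    simp
  · intro v _
    rw [Matrix.mulVec_mulVec, ← Matrix.GeneralLinearGroup.coe_mul, mul_inv_cancel]
    simp
  · intro v _
    simp [actHom_lin]

lemma actHom_flagMap {I : Composition n} {m : ℕ} (hm : IsBlockBoundary I m)
    {g : GL (Fin n) F} (hg : g ∈ parabolic F I) (y : MvPolynomial (Fin n) F) :
    actHom g (flagMap F n m y) = flagMap F n m (actHom g y) := by
  rw [← eval_flagPoly, ← eval_flagPoly]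
  conv_rhs => rw [← map_flagPoly hm hg, Polynomial.eval_map]
  exact (Polynomial.eval₂_at_apply (actHom g).toRingHom y).symm

variable (F n) in
/-- The product `∏_{k < m} flagMap k x_k`: one linear form from each line in the span of the
first `m` variables. Up to sign it is the determinant of the matrix `x_j ^ (q ^ i)`. -/
def mooreProd (m : ℕ) : MvPolynomial (Fin n) F :=
  ∏ k ∈ Finset.range m, flagMap F n k (flagVar F n k)

lemma mooreProd_ne_zero {m : ℕ} (hm : m ≤ n) : mooreProd F n m ≠ 0 := by
  refine Finset.prod_ne_zero_iff.2 fun k hk => ?_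
  have := flagMap_X_ne_zero (F := F) (⟨k, (Finset.mem_range.1 hk).trans_le hm⟩ : Fin n)
  rwa [← flagVar_val] at this

lemma isHomogeneous_mooreProd (m : ℕ) :
    (mooreProd F n m).IsHomogeneous (∑ k ∈ Finset.range m, q ^ k) :=
  MvPolynomial.IsHomogeneous.prod _ _ _ fun k _ =>
    isHomogeneous_flagMap k (isHomogeneous_flagVar k)

lemma coeff_one_flagPoly (m : ℕ) :
    (flagPoly F n m).coeff 1 = (-1) ^ m * mooreProd F n m ^ (q - 1) := by
  induction m with
  | zero => simp [flagPoly, mooreProd]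
  | succ m ih =>
    have h : (flagPoly F n m ^ q).coeff 1 = 0 :=
      Polynomial.X_pow_dvd_iff.1 (pow_dvd_pow_of_dvd (X_dvd_flagPoly m) q) 1 one_lt_q
    rw [flagPoly, Polynomial.coeff_sub, h, Polynomial.coeff_C_mul, ih, mooreProd, mooreProd,
      Finset.prod_range_succ, mul_pow]
    ring

/-- Up to sign, `mooreProd m ^ (q - 1)` is the product of the nonzero linear forms in the first
`m` variables, hence invariant under the elements that permute these forms. -/
lemma actHom_mooreProd_pow {I : Composition n} {m : ℕ} (hm : IsBlockBoundary I m)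
    {g : GL (Fin n) F} (hg : g ∈ parabolic F I) :
    actHom g (mooreProd F n m ^ (q - 1)) = mooreProd F n m ^ (q - 1) := by
  have h := congrArg (fun p => (-1) ^ m * Polynomial.coeff p 1) (map_flagPoly hm hg)
  simp only [Polynomial.coeff_map, coeff_one_flagPoly, map_mul, map_pow, map_neg, map_one] at h
  simpa [← mul_assoc, ← mul_pow] using h

end Flag

/-! ### Graded dimension counts -/

section Graded

variable {F : Type*} [Field F] {n : ℕ}

/-- The homogeneous component of degree `d - a` of `E`, and zero if `d < a`. -/
def shiftedPiece (E : Submodule F (MvPolynomial (Fin n) F)) (d a : ℕ) :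
    Submodule F (MvPolynomial (Fin n) F) :=
  if a ≤ d then E ⊓ MvPolynomial.homogeneousSubmodule (Fin n) F (d - a) else ⊥

lemma shiftedPiece_of_le {E : Submodule F (MvPolynomial (Fin n) F)} {d a : ℕ} (h : a ≤ d) :
    shiftedPiece E d a = E ⊓ MvPolynomial.homogeneousSubmodule (Fin n) F (d - a) := if_pos h

lemma shiftedPiece_of_lt {E : Submodule F (MvPolynomial (Fin n) F)} {d a : ℕ} (h : d < a) :
    shiftedPiece E d a = ⊥ := if_neg (not_le.2 h)

/-- The Hilbert series of a subspace of the polynomial ring. -/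
def gradedSeries (E : Submodule F (MvPolynomial (Fin n) F)) : PowerSeries ℚ :=
  PowerSeries.mk fun d =>
    (Module.finrank F ↥(E ⊓ MvPolynomial.homogeneousSubmodule (Fin n) F d) : ℚ)

instance finite_homogeneousSubmodule (d : ℕ) :
    Module.Finite F (MvPolynomial.homogeneousSubmodule (Fin n) F d) :=
  Module.Finite.iff_fg.2 (MvPolynomial.homogeneousSubmodule_fg _ _ _)

instance finite_shiftedPiece (E : Submodule F (MvPolynomial (Fin n) F)) (d a : ℕ) :
    Module.Finite F (shiftedPiece E d a) := by
  rcases le_or_gt a d with h | h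
  · rw [shiftedPiece_of_le h]
    exact Submodule.finiteDimensional_of_le inf_le_right
  · rw [shiftedPiece_of_lt h]
    infer_instance

lemma shiftedPiece_le (E : Submodule F (MvPolynomial (Fin n) F)) (d a : ℕ) :
    shiftedPiece E d a ≤ E := by
  rcases le_or_gt a d with h | h
  · exact (shiftedPiece_of_le h).trans_le inf_le_left
  · exact (shiftedPiece_of_lt h).trans_le bot_le

lemma finrank_shiftedPiece (E : Submodule F (MvPolynomial (Fin n) F)) (d a : ℕ) :
    (Module.finrank F (shiftedPiece E d a) : ℚ)
      = PowerSeries.coeff d (PowerSeries.X ^ a * gradedSeries E) := by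
  rw [PowerSeries.coeff_X_pow_mul', gradedSeries, PowerSeries.coeff_mk]
  rcases le_or_gt a d with h | h
  · rw [shiftedPiece_of_le h, if_pos h]
  · rw [shiftedPiece_of_lt h, if_neg (not_le.2 h), finrank_bot, Nat.cast_zero]

/-- The dimension of a space with a parametrization by tuples of homogeneous elements of `E` of
prescribed degrees. -/
lemma finrank_eq_sum_finrank_shiftedPiece {ι M : Type*} [Fintype ι] [AddCommGroup M] [Module F M]
    {E : Submodule F (MvPolynomial (Fin n) F)} {d : ℕ} {w : ι → ℕ} {T : Submodule F M}
    (Φ : (ι → MvPolynomial (Fin n) F) →ₗ[F] M)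
    (hinj : ∀ e, (∀ i, e i ∈ E) → Φ e = 0 → e = 0)
    (hmem : ∀ e, (∀ i, e i ∈ shiftedPiece E d (w i)) → Φ e ∈ T)
    (hsurj : ∀ t ∈ T, ∃ e, (∀ i, e i ∈ shiftedPiece E d (w i)) ∧ Φ e = t) :
    Module.finrank F T = ∑ i, Module.finrank F (shiftedPiece E d (w i)) := by
  let inc : (∀ i, shiftedPiece E d (w i)) →ₗ[F] (ι → MvPolynomial (Fin n) F) :=
    LinearMap.pi fun i => (shiftedPiece E d (w i)).subtype ∘ₗ LinearMap.proj i
  let Ψ : (∀ i, shiftedPiece E d (w i)) →ₗ[F] T :=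
    (Φ ∘ₗ inc).codRestrict T fun e => hmem _ fun i => (e i).2
  have hΨ : Function.Bijective Ψ := by
    constructor
    · rw [injective_iff_map_eq_zero]
      intro e he
      have h := hinj (inc e) (fun i => shiftedPiece_le _ _ _ (e i).2) (congrArg Subtype.val he)
      ext i : 2
      exact congrFun h i
    · rintro ⟨t, ht⟩
      obtain ⟨e, he, rfl⟩ := hsurj t ht
      exact ⟨fun i => ⟨e i, he i⟩, rfl⟩
  rw [← (LinearEquiv.ofBijective Ψ hΨ).finrank_eq, Module.finrank_pi_fintype]

lemma gradedSeries_top_mul :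
    gradedSeries (⊤ : Submodule F (MvPolynomial (Fin n) F)) * (1 - PowerSeries.X) ^ n = 1 := by
  have h : gradedSeries (⊤ : Submodule F (MvPolynomial (Fin n) F)) = PowerSeries.mk 1 ^ n := by
    ext d
    have h1 : Module.finrank F (MvPolynomial.homogeneousSubmodule (Fin n) F d)
        = (Finset.finsuppAntidiag (Finset.univ : Finset (Fin n)) d).card := by
      rw [MvPolynomial.homogeneousSubmodule_eq_finsupp_supported]
      refine (Module.finrank_eq_nat_card_basis (MvPolynomial.basisRestrictSupport F _)).trans ?_
      rw [← Fintype.card_coe, ← Nat.card_eq_fintype_card]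
      refine Nat.card_congr (Equiv.subtypeEquivRight fun x => ?_)
      simp [Finsupp.degree_eq_sum]
    rw [gradedSeries, PowerSeries.coeff_mk, top_inf_eq, h1, ← Fin.prod_const,
      PowerSeries.coeff_prod]
    simp
  rw [h, ← mul_pow, PowerSeries.mk_one_mul_one_sub_eq_one, one_pow]

lemma homogeneousComponent_mul_mem {E : Subalgebra F (MvPolynomial (Fin n) F)}
    {f g : MvPolynomial (Fin n) F}
    (hf : ∀ d, MvPolynomial.homogeneousComponent d f ∈ E)
    (hg : ∀ d, MvPolynomial.homogeneousComponent d g ∈ E) (d : ℕ) :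
    MvPolynomial.homogeneousComponent d (f * g) ∈ E := by
  rw [← MvPolynomial.sum_homogeneousComponent f, ← MvPolynomial.sum_homogeneousComponent g,
    Finset.sum_mul_sum, map_sum]
  refine sum_mem fun i _ => ?_
  rw [map_sum]
  refine sum_mem fun j _ => ?_
  rw [MvPolynomial.homogeneousComponent_of_mem
    ((MvPolynomial.homogeneousComponent_isHomogeneous i f).mul
      (MvPolynomial.homogeneousComponent_isHomogeneous j g))]
  split_ifs
  · exact mul_mem (hf i) (hg j)
  · exact zero_mem E

lemma homogeneousComponent_mul_of_isHomogeneous {f : MvPolynomial (Fin n) F} {a : ℕ}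
    (hf : f.IsHomogeneous a) (g : MvPolynomial (Fin n) F) (d : ℕ) :
    MvPolynomial.homogeneousComponent d (f * g)
      = if a ≤ d then f * MvPolynomial.homogeneousComponent (d - a) g else 0 := by
  have key : ∀ i, MvPolynomial.homogeneousComponent d
      (f * MvPolynomial.homogeneousComponent i g)
        = if a ≤ d then f * MvPolynomial.homogeneousComponent (d - a)
            (MvPolynomial.homogeneousComponent i g) else 0 := fun i => by
    have hi := MvPolynomial.homogeneousComponent_isHomogeneous i g
    rw [MvPolynomial.homogeneousComponent_of_mem (hf.mul hi),
      MvPolynomial.homogeneousComponent_of_mem hi]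
    split_ifs <;> first | rfl | omega | simp
  conv_lhs => rw [← MvPolynomial.sum_homogeneousComponent g]
  conv_rhs => rw [← MvPolynomial.sum_homogeneousComponent g]
  rw [Finset.mul_sum, map_sum, Finset.sum_congr rfl fun i _ => key i]
  split_ifs
  · rw [map_sum, Finset.mul_sum]
  · exact Finset.sum_const_zero

end Graded

/-! ### The Hilbert series of the polynomial invariants -/

section Tower

variable {F : Type*} [Field F] {n : ℕ} (I : Composition n)

variable (F) in
/-- The algebra `S(V)^{P_I}` of polynomial invariants of the parabolic subgroup. -/
def symInvariants : Subalgebra F (MvPolynomial (Fin n) F) where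
  carrier := {f | ∀ g ∈ parabolic F I, actHom g f = f}
  mul_mem' hf hg g h := by rw [map_mul, hf g h, hg g h]
  add_mem' hf hg g h := by rw [map_add, hf g h, hg g h]
  algebraMap_mem' c g _ := AlgHom.commutes _ c

variable {I}

lemma homogeneousComponent_actHom (g : GL (Fin n) F) (f : MvPolynomial (Fin n) F) (d : ℕ) :
    MvPolynomial.homogeneousComponent d (actHom g f)
      = actHom g (MvPolynomial.homogeneousComponent d f) := by
  conv_lhs => rw [← MvPolynomial.sum_homogeneousComponent f]
  conv_rhs => rw [← MvPolynomial.sum_homogeneousComponent f]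
  simp only [map_sum]
  refine Finset.sum_congr rfl fun i _ => ?_
  have h := MvPolynomial.homogeneousComponent_isHomogeneous i f
  rw [MvPolynomial.homogeneousComponent_of_mem (isHomogeneous_actHom g h),
    MvPolynomial.homogeneousComponent_of_mem h]
  split_ifs <;> simp

lemma homogeneousComponent_mem_symInvariants {f : MvPolynomial (Fin n) F}
    (hf : f ∈ symInvariants F I) (d : ℕ) :
    MvPolynomial.homogeneousComponent d f ∈ symInvariants F I := fun g hg => by
  rw [← homogeneousComponent_actHom, hf g hg]

variable (F I) in
/-- The subalgebra generated by the polynomial invariants and the first `k` variables. -/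
def invariantTower (k : ℕ) : Subalgebra F (MvPolynomial (Fin n) F) :=
  Algebra.adjoin F ((symInvariants F I : Set (MvPolynomial (Fin n) F))
    ∪ {f | ∃ j : Fin n, (j : ℕ) < k ∧ f = MvPolynomial.X j})

lemma symInvariants_le_invariantTower (k : ℕ) : symInvariants F I ≤ invariantTower F I k :=
  fun _ h => Algebra.subset_adjoin (Or.inl h)

lemma X_mem_invariantTower {k : ℕ} {j : Fin n} (h : (j : ℕ) < k) :
    MvPolynomial.X j ∈ invariantTower F I k :=
  Algebra.subset_adjoin (Or.inr ⟨j, h, rfl⟩)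

lemma invariantTower_mono {k m : ℕ} (h : k ≤ m) : invariantTower F I k ≤ invariantTower F I m := by
  refine Algebra.adjoin_mono (Set.union_subset_union_right _ ?_)
  rintro _ ⟨j, hj, rfl⟩
  exact ⟨j, hj.trans_le h, rfl⟩

lemma invariantTower_zero : invariantTower F I 0 = symInvariants F I := by
  refine le_antisymm (Algebra.adjoin_le ?_) (symInvariants_le_invariantTower 0)
  rintro f (hf | ⟨j, hj, _⟩)
  · exact hf
  · exact absurd hj (Nat.not_lt_zero _)

lemma invariantTower_last : invariantTower F I n = ⊤ := by
  rw [eq_top_iff, ← MvPolynomial.adjoin_range_X]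
  refine Algebra.adjoin_mono ?_
  rintro _ ⟨j, rfl⟩
  exact Or.inr ⟨j, j.2, rfl⟩

lemma homogeneousComponent_mem_invariantTower {k : ℕ} {f : MvPolynomial (Fin n) F}
    (hf : f ∈ invariantTower F I k) (d : ℕ) :
    MvPolynomial.homogeneousComponent d f ∈ invariantTower F I k := by
  induction hf using Algebra.adjoin_induction generalizing d with
  | mem f hf =>
    rcases hf with hf | ⟨j, hj, rfl⟩
    · exact symInvariants_le_invariantTower k (homogeneousComponent_mem_symInvariants hf d)
    · rw [MvPolynomial.homogeneousComponent_of_mem (MvPolynomial.isHomogeneous_X F j)]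
      split_ifs
      · exact X_mem_invariantTower hj
      · exact zero_mem _
  | algebraMap c =>
    rw [MvPolynomial.algebraMap_eq,
      MvPolynomial.homogeneousComponent_of_mem (MvPolynomial.isHomogeneous_C _ c)]
    split_ifs
    · exact Subalgebra.algebraMap_mem _ c
    · exact zero_mem _
  | add f g _ _ hf hg => rw [map_add]; exact add_mem (hf d) (hg d)
  | mul f g _ _ hf hg => exact homogeneousComponent_mul_mem hf hg d

lemma actHom_eq_self_of_mem_invariantTower {k : ℕ} {f : MvPolynomial (Fin n) F}
    (hf : f ∈ invariantTower F I k) {g : GL (Fin n) F} (hg : g ∈ parabolic F I)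
    (hX : ∀ j : Fin n, (j : ℕ) < k → actHom g (MvPolynomial.X j) = MvPolynomial.X j) :
    actHom g f = f := by
  have h : invariantTower F I k ≤ AlgHom.equalizer (actHom g) (AlgHom.id F _) := by
    refine Algebra.adjoin_le ?_
    rintro f (hf | ⟨j, hj, rfl⟩)
    · exact hf g hg
    · exact hX j hj
  exact h hf

lemma exists_aeval_of_mem_invariantTower_succ {k : Fin n} {f : MvPolynomial (Fin n) F}
    (hf : f ∈ invariantTower F I (k + 1)) :
    ∃ p : Polynomial (invariantTower F I k), Polynomial.aeval (MvPolynomial.X k) p = f := by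
  have h : invariantTower F I (k + 1) ≤ ((Polynomial.aeval (MvPolynomial.X k) :
      Polynomial (invariantTower F I k) →ₐ[_] MvPolynomial (Fin n) F).range.restrictScalars F) := by
    refine Algebra.adjoin_le ?_
    rintro f (hf | ⟨j, hj, rfl⟩)
    · exact ⟨Polynomial.C ⟨f, symInvariants_le_invariantTower _ hf⟩, by simp⟩
    · rcases Nat.lt_succ_iff_lt_or_eq.1 hj with h | h
      · exact ⟨Polynomial.C ⟨MvPolynomial.X j, X_mem_invariantTower h⟩, by simp⟩
      · exact ⟨Polynomial.X, by rw [Fin.ext h]; simp⟩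
  exact h hf

variable [Fintype F]

local notation "q" => Fintype.card F

lemma lin_mem_invariantTower {k : ℕ} {v : Fin n → F} (hv : v ∈ flagSpace F n k) :
    lin v ∈ invariantTower F I k := by
  rw [lin_apply]
  refine sum_mem fun j _ => ?_
  by_cases hj : (j : ℕ) < k
  · exact mul_mem (Subalgebra.algebraMap_mem _ _) (X_mem_invariantTower hj)
  · rw [mem_flagSpace.1 hv j (not_lt.mp hj), map_zero, zero_mul]
    exact zero_mem _

lemma flagPoly_mem_lifts {k : ℕ} (hk : k ≤ n) :
    flagPoly F n k ∈ Polynomial.lifts (invariantTower F I k).val.toRingHom := by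
  rw [flagPoly_eq_prod hk]
  refine prod_mem fun v hv => ?_
  refine (Polynomial.mem_lifts _).2
    ⟨Polynomial.X - Polynomial.C ⟨lin v, lin_mem_invariantTower hv⟩, ?_⟩
  simp

lemma flagPoly_blockEnd_mem_lifts (k : Fin n) :
    flagPoly F n (blockEnd I k) ∈ Polynomial.lifts (invariantTower F I k).val.toRingHom := by
  rw [Polynomial.lifts_iff_coeff_lifts]
  intro i
  refine ⟨⟨(flagPoly F n (blockEnd I k)).coeff i,
    symInvariants_le_invariantTower _ fun g hg => ?_⟩, rfl⟩
  conv_rhs => rw [← map_flagPoly (isBlockBoundary_blockEnd I k) hg]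
  rw [Polynomial.coeff_map]
  rfl

/-- The monic polynomial with the linear forms `v` for roots, where `v` runs over the orbit of
`x_k` under the elements of the parabolic subgroup that fix the variables before `x_k`. -/
lemma exists_monic_aeval_X_eq_zero (k : Fin n) :
    ∃ h : Polynomial (invariantTower F I k), h.Monic ∧
      h.natDegree = q ^ blockEnd I k - q ^ (k : ℕ) ∧
      Polynomial.aeval (MvPolynomial.X k : MvPolynomial (Fin n) F) h = 0 := by
  have hinj : Function.Injective (invariantTower F I k).val.toRingHom := Subtype.val_injective
  obtain ⟨P, hP, hPd, hPm⟩ := Polynomial.lifts_and_natDegree_eq_and_monic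
    (flagPoly_blockEnd_mem_lifts (F := F) (I := I) k) (flagPoly_monic_natDegree _).1
  obtain ⟨K, hK, hKd, hKm⟩ := Polynomial.lifts_and_natDegree_eq_and_monic
    (flagPoly_mem_lifts (F := F) (I := I) k.2.le) (flagPoly_monic_natDegree _).1
  have hdvd : K ∣ P := by
    rw [← Polynomial.modByMonic_eq_zero_iff_dvd hKm]
    apply Polynomial.map_injective _ hinj
    rw [Polynomial.map_modByMonic _ hKm, hP, hK, Polynomial.map_zero,
      Polynomial.modByMonic_eq_zero_iff_dvd (flagPoly_monic_natDegree _).1]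
    exact flagPoly_dvd_of_le (lt_blockEnd I k).le
  obtain ⟨h, rfl⟩ := hdvd
  have hm : h.Monic := hKm.of_mul_monic_left hPm
  refine ⟨h, hm, ?_, ?_⟩
  · rw [hKm.natDegree_mul hm, hKd, (flagPoly_monic_natDegree _).2,
      (flagPoly_monic_natDegree _).2] at hPd
    omega
  · have aeval_eq : ∀ Q : Polynomial (invariantTower F I k), Polynomial.aeval
        (MvPolynomial.X k : MvPolynomial (Fin n) F) Q
          = (Q.map (invariantTower F I k).val.toRingHom).eval (MvPolynomial.X k) := fun Q => by
      rw [Polynomial.eval_map]; rfl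
    have h1 : Polynomial.aeval (MvPolynomial.X k : MvPolynomial (Fin n) F) (K * h) = 0 := by
      rw [aeval_eq, hP, eval_flagPoly, flagMap_X_eq_zero (lt_blockEnd I k)]
    rw [map_mul, aeval_eq K, hK, eval_flagPoly] at h1
    exact (mul_eq_zero.1 h1).resolve_left (flagMap_X_ne_zero k)

lemma exists_eq_sum_of_mem_invariantTower_succ {k : Fin n} {f : MvPolynomial (Fin n) F}
    (hf : f ∈ invariantTower F I (k + 1)) :
    ∃ e : Fin (q ^ blockEnd I k - q ^ (k : ℕ)) → MvPolynomial (Fin n) F,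
      (∀ a, e a ∈ invariantTower F I k) ∧ f = ∑ a, e a * MvPolynomial.X k ^ (a : ℕ) := by
  obtain ⟨p, rfl⟩ := exists_aeval_of_mem_invariantTower_succ hf
  obtain ⟨h, hm, hd, h0⟩ := exists_monic_aeval_X_eq_zero (F := F) (I := I) k
  have hpos : 0 < q ^ blockEnd I k - q ^ (k : ℕ) :=
    Nat.sub_pos_of_lt (Nat.pow_lt_pow_right one_lt_q (lt_blockEnd I k))
  have hlt : (p %ₘ h).natDegree < q ^ blockEnd I k - q ^ (k : ℕ) := by
    rw [← hd]
    refine Polynomial.natDegree_modByMonic_lt _ hm ?_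
    rintro rfl
    simp at hd
    omega
  refine ⟨fun a => ((p %ₘ h).coeff a : invariantTower F I k), fun a => Subtype.prop _, ?_⟩
  rw [← Polynomial.aeval_modByMonic_eq_self_of_root h0, Polynomial.aeval_eq_sum_range' hlt,
    ← Fin.sum_univ_eq_sum_range fun i =>
      (p %ₘ h).coeff i • (MvPolynomial.X k : MvPolynomial (Fin n) F) ^ i]
  rfl

lemma eq_zero_of_sum_mul_pow_eq_zero {k : Fin n}
    {e : Fin (q ^ blockEnd I k - q ^ (k : ℕ)) → MvPolynomial (Fin n) F}
    (he : ∀ a, e a ∈ invariantTower F I k)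
    (h0 : ∑ a, e a * MvPolynomial.X k ^ (a : ℕ) = 0) : e = 0 := by
  classical
  set p : Polynomial (MvPolynomial (Fin n) F) :=
    ∑ a, Polynomial.C (e a) * Polynomial.X ^ (a : ℕ) with hp
  have hpc : ∀ a : Fin (q ^ blockEnd I k - q ^ (k : ℕ)), p.coeff (a : ℕ) = e a := by
    intro a
    simp [hp, Polynomial.finsetSum_coeff, Polynomial.coeff_X_pow, Fin.val_inj]
  have hlt : q ^ (k : ℕ) < q ^ blockEnd I k := Nat.pow_lt_pow_right one_lt_q (lt_blockEnd I k)
  have hpd : p.natDegree < q ^ blockEnd I k - q ^ (k : ℕ) := by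
    refine (Nat.lt_iff_le_pred (by omega)).2
      (Polynomial.natDegree_sum_le_of_forall_le _ _ fun a _ => ?_)
    refine (Polynomial.natDegree_C_mul_X_pow_le _ _).trans ?_
    exact Nat.le_sub_one_of_lt a.2
  -- The elements of the parabolic subgroup that fix the coefficients carry the root `x_k` of `p`
  -- to all linear forms of the flag step of the block that are not roots of `flagPoly k`.
  have hroot : ∀ v ∈ flagSpace F n (blockEnd I k), (p * flagPoly F n k).eval (lin v) = 0 := by
    intro v hv
    rw [Polynomial.eval_mul, eval_flagPoly]
    by_cases hvk : v ∈ flagSpace F n k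
    · rw [flagMap_lin_eq_zero hvk, mul_zero]
    · rw [mem_flagSpace] at hv hvk
      push Not at hvk
      obtain ⟨g, hg, hgk, hgj⟩ := exists_parabolic_actHom_X k v hv hvk
      have h1 := congrArg (actHom g) h0
      simp only [map_sum, map_mul, map_pow, hgk, map_zero] at h1
      have h2 : p.eval (lin v) = 0 := by
        rw [hp, Polynomial.eval_finsetSum, ← h1]
        refine Finset.sum_congr rfl fun a _ => ?_
        rw [actHom_eq_self_of_mem_invariantTower (he a) hg fun j hj => hgj j hj]
        simp
      rw [h2, zero_mul]
  have hprod : p * flagPoly F n k = 0 := by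
    refine Polynomial.eq_zero_of_natDegree_lt_card_of_eval_eq_zero' _
      ((flagSpace F n (blockEnd I k)).image lin) ?_ ?_
    · intro y hy
      obtain ⟨v, hv, rfl⟩ := Finset.mem_image.1 hy
      exact hroot v hv
    · rw [Finset.card_image_of_injective _ lin_injective, card_flagSpace (blockEnd_le I k)]
      refine (Polynomial.natDegree_mul_le).trans_lt ?_
      rw [(flagPoly_monic_natDegree _).2]
      omega
  have hp0 := (mul_eq_zero.1 hprod).resolve_right (flagPoly_monic_natDegree _).1.ne_zero
  ext1 a
  rw [← hpc, hp0, Polynomial.coeff_zero, Pi.zero_apply]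

lemma gradedSeries_invariantTower_succ (k : Fin n) :
    gradedSeries (Subalgebra.toSubmodule (invariantTower F I (k + 1)))
      = gradedSeries (Subalgebra.toSubmodule (invariantTower F I k))
        * ∑ a ∈ Finset.range (q ^ blockEnd I k - q ^ (k : ℕ)), PowerSeries.X ^ a := by
  ext d
  rw [gradedSeries, PowerSeries.coeff_mk, mul_comm, Finset.sum_mul, map_sum,
    ← Fin.sum_univ_eq_sum_range fun a => PowerSeries.coeff d (PowerSeries.X ^ a *
      gradedSeries (Subalgebra.toSubmodule (invariantTower F I k)))]
  simp only [← finrank_shiftedPiece]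
  rw [← Nat.cast_sum]
  congr 1
  refine finrank_eq_sum_finrank_shiftedPiece
    (LinearMap.lsum F _ F fun a => LinearMap.mulRight F (MvPolynomial.X k ^ (a : ℕ))) ?_ ?_ ?_
  · intro e he h0
    exact eq_zero_of_sum_mul_pow_eq_zero he (by simpa using h0)
  · intro e he
    simp only [LinearMap.lsum_apply, LinearMap.sum_apply, LinearMap.comp_apply,
      LinearMap.proj_apply, LinearMap.mulRight_apply]
    refine sum_mem fun a _ => ?_
    have h := he a
    rcases le_or_gt (a : ℕ) d with had | had
    · rw [shiftedPiece_of_le had] at h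
      refine ⟨Subalgebra.mul_mem _ (invariantTower_mono (Nat.le_succ _) h.1)
        (pow_mem (X_mem_invariantTower (Nat.lt_succ_self _)) _), ?_⟩
      have h2 := MvPolynomial.IsHomogeneous.mul h.2 (MvPolynomial.isHomogeneous_X_pow k (a : ℕ))
      rwa [Nat.sub_add_cancel had] at h2
    · rw [shiftedPiece_of_lt had, Submodule.mem_bot] at h
      rw [h, zero_mul]
      exact zero_mem _
  · rintro t ⟨ht, hd⟩
    obtain ⟨e, he, rfl⟩ := exists_eq_sum_of_mem_invariantTower_succ ht
    refine ⟨fun a => if (a : ℕ) ≤ d then MvPolynomial.homogeneousComponent (d - a) (e a) else 0,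
      fun a => ?_, ?_⟩
    · rcases le_or_gt (a : ℕ) d with had | had
      · simp only [if_pos had, shiftedPiece_of_le had]
        exact ⟨homogeneousComponent_mem_invariantTower (he a) _,
          MvPolynomial.homogeneousComponent_isHomogeneous _ _⟩
      · simp only [if_neg (not_le.2 had)]
        exact zero_mem _
    · rw [← MvPolynomial.homogeneousComponent_eq_self hd, map_sum]
      simp only [LinearMap.lsum_apply, LinearMap.sum_apply, LinearMap.comp_apply,
        LinearMap.proj_apply, LinearMap.mulRight_apply]
      refine Finset.sum_congr rfl fun a _ => ?_
      rw [mul_comm (e a), homogeneousComponent_mul_of_isHomogeneous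
        (MvPolynomial.isHomogeneous_X_pow k (a : ℕ)), ite_mul, zero_mul, mul_comm]

/-- The Hilbert series of the ring of polynomial invariants. -/
theorem gradedSeries_symInvariants_mul_prod :
    gradedSeries (Subalgebra.toSubmodule (symInvariants F I))
      * ∏ k : Fin n, (1 - PowerSeries.X ^ (q ^ blockEnd I k - q ^ (k : ℕ))) = 1 := by
  have step : ∀ k : Fin n, gradedSeries (Subalgebra.toSubmodule (invariantTower F I (k + 1)))
      * (1 - PowerSeries.X) = gradedSeries (Subalgebra.toSubmodule (invariantTower F I k))
        * (1 - PowerSeries.X ^ (q ^ blockEnd I k - q ^ (k : ℕ))) := fun k => by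
    rw [gradedSeries_invariantTower_succ, mul_assoc, geom_sum_mul_neg]
  have key : ∀ m (hm : m ≤ n),
      gradedSeries (Subalgebra.toSubmodule (invariantTower F I m)) * (1 - PowerSeries.X) ^ m
        = gradedSeries (Subalgebra.toSubmodule (symInvariants F I))
          * ∏ k : Fin m, (1 - PowerSeries.X ^
              (q ^ blockEnd I (Fin.castLE hm k) - q ^ (k : ℕ))) := by
    intro m
    induction m with
    | zero => intro _; simp [invariantTower_zero]
    | succ m ih =>
      intro hm
      rw [Fin.prod_univ_castSucc, ← mul_assoc]
      have h1 := ih (Nat.le_of_succ_le hm)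
      have h2 := step ⟨m, hm⟩
      simp only at h2
      rw [pow_succ', ← mul_assoc, h2, mul_right_comm, h1]
      rfl
  have h := key n le_rfl
  rw [invariantTower_last, Algebra.top_toSubmodule, gradedSeries_top_mul] at h
  exact h.symm

end Tower

/-! ### Evaluation of differential forms on rows -/

section Forms

variable {F : Type*} [Field F] {n : ℕ}

/-- The `F`-linear map `F^n → F[x_1, …, x_n]` whose values on the standard basis are the entries
of the row `φ`. -/
def rowMap (φ : Fin n → MvPolynomial (Fin n) F) : (Fin n → F) →ₗ[F] MvPolynomial (Fin n) F :=
  Fintype.linearCombination F φ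

lemma rowMap_apply (φ : Fin n → MvPolynomial (Fin n) F) (v : Fin n → F) :
    rowMap φ v = ∑ j, v j • φ j := rfl

lemma rowMap_add (φ ψ : Fin n → MvPolynomial (Fin n) F) (v : Fin n → F) :
    rowMap (φ + ψ) v = rowMap φ v + rowMap ψ v := by
  simp [rowMap_apply, Finset.sum_add_distrib]

lemma rowMap_smul (c : MvPolynomial (Fin n) F) (φ : Fin n → MvPolynomial (Fin n) F)
    (v : Fin n → F) : rowMap (c • φ) v = c * rowMap φ v := by
  simp [rowMap_apply, Finset.mul_sum]

lemma rowMap_single_one (l : Fin n) (v : Fin n → F) :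
    rowMap (Pi.single l 1) v = algebraMap F _ (v l) := by
  rw [Algebra.algebraMap_eq_smul_one]
  simp [rowMap_apply, Pi.single_apply]

lemma rowMap_single (φ : Fin n → MvPolynomial (Fin n) F) (j : Fin n) :
    rowMap φ (Pi.single j 1) = φ j := by
  simp [rowMap]

/-- The alternating map that sends vectors `v_1, …, v_k` to the determinant of the matrix of
values of the rows `θ_1, …, θ_k` on them. -/
def rowDet {k : ℕ} (θ : Fin k → Fin n → MvPolynomial (Fin n) F) :
    (Fin n → F) [⋀^Fin k]→ₗ[F] MvPolynomial (Fin n) F :=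
  AlternatingMap.compLinearMap
    { (Matrix.detRowAlternating (n := Fin k)
        (R := MvPolynomial (Fin n) F)).toMultilinearMap.restrictScalars F with
      map_eq_zero_of_eq' := (Matrix.detRowAlternating (n := Fin k)
        (R := MvPolynomial (Fin n) F)).map_eq_zero_of_eq' }
    (LinearMap.pi fun i => rowMap (θ i))

lemma rowDet_apply {k : ℕ} (θ : Fin k → Fin n → MvPolynomial (Fin n) F)
    (v : Fin k → Fin n → F) :
    rowDet θ v = (Matrix.of fun i j => rowMap (θ i) (v j)).det := by
  rw [← Matrix.det_transpose]
  rfl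

/-- Evaluation of `S(V) ⊗ ∧(V)` on `k` rows, where a row stands for a linear map `V → S(V)`: the
`S(V)`-linear map that sends `v_1 ∧ ⋯ ∧ v_k` to the determinant of the values of the rows, and
that vanishes on the other exterior degrees. -/
def formEval {k : ℕ} (θ : Fin k → Fin n → MvPolynomial (Fin n) F) :
    MvPolynomial (Fin n) F ⊗[F] ExteriorAlgebra F (Fin n → F) →ₗ[MvPolynomial (Fin n) F]
      MvPolynomial (Fin n) F :=
  (ExteriorAlgebra.liftAlternating
    (Pi.single (M := fun i => (Fin n → F) [⋀^Fin i]→ₗ[F] MvPolynomial (Fin n) F) k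
      (rowDet θ))).liftBaseChange _

lemma formEval_tmul_ιMulti {k : ℕ} (θ : Fin k → Fin n → MvPolynomial (Fin n) F)
    (s : MvPolynomial (Fin n) F) (v : Fin k → Fin n → F) :
    formEval θ (s ⊗ₜ ExteriorAlgebra.ιMulti F k v)
      = s * (Matrix.of fun i j => rowMap (θ i) (v j)).det := by
  rw [formEval, LinearMap.liftBaseChange_tmul, ExteriorAlgebra.liftAlternating_apply_ιMulti,
    Pi.single_eq_same, rowDet_apply, smul_eq_mul]

lemma formEval_tmul_ιMulti_of_ne {k m : ℕ} (h : m ≠ k)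
    (θ : Fin k → Fin n → MvPolynomial (Fin n) F)
    (s : MvPolynomial (Fin n) F) (v : Fin m → Fin n → F) :
    formEval θ (s ⊗ₜ ExteriorAlgebra.ιMulti F m v) = 0 := by
  rw [formEval, LinearMap.liftBaseChange_tmul, ExteriorAlgebra.liftAlternating_apply_ιMulti,
    Pi.single_eq_of_ne h, AlternatingMap.zero_apply, smul_zero]

lemma tensor_hom_ext {N : Type*} [AddCommGroup N] [Module F N]
    {f g : MvPolynomial (Fin n) F ⊗[F] ExteriorAlgebra F (Fin n → F) →ₗ[F] N}
    (h : ∀ s m (v : Fin m → Fin n → F), f (s ⊗ₜ ExteriorAlgebra.ιMulti F m v)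
      = g (s ⊗ₜ ExteriorAlgebra.ιMulti F m v)) : f = g := by
  refine TensorProduct.ext (LinearMap.ext fun s => ExteriorAlgebra.lhom_ext fun m => ?_)
  ext v
  exact h s m v

/-- The linear map `V → S(V)` with row `φ` commutes with `g`, as tested on the standard basis. -/
def IsEquivariantRow (g : GL (Fin n) F) (φ : Fin n → MvPolynomial (Fin n) F) : Prop :=
  ∀ j, actHom g (φ j) = rowMap φ fun l => g l j

lemma IsEquivariantRow.actHom_rowMap {g : GL (Fin n) F} {φ : Fin n → MvPolynomial (Fin n) F}
    (h : IsEquivariantRow g φ) (v : Fin n → F) :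
    actHom g (rowMap φ v) = rowMap φ ((g : Matrix (Fin n) (Fin n) F).mulVec v) := by
  have : (actHom g).toLinearMap ∘ₗ rowMap φ
      = rowMap φ ∘ₗ Matrix.mulVecLin (g : Matrix (Fin n) (Fin n) F) := by
    refine LinearMap.pi_ext' fun j => LinearMap.ext_ring ?_
    simp only [LinearMap.comp_apply, LinearMap.single_apply, rowMap_single,
      AlgHom.toLinearMap_apply, h j, Matrix.mulVecLin_apply, Matrix.mulVec_single_one]
    rfl
  exact LinearMap.congr_fun this v

lemma symExtRep_tmul_ιMulti (g : GL (Fin n) F) (s : MvPolynomial (Fin n) F) (m : ℕ)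
    (v : Fin m → Fin n → F) :
    symExtRep F n g (s ⊗ₜ ExteriorAlgebra.ιMulti F m v)
      = actHom g s ⊗ₜ ExteriorAlgebra.ιMulti F m
          fun i => (g : Matrix (Fin n) (Fin n) F).mulVec (v i) := by
  change actHom g s ⊗ₜ ExteriorAlgebra.map _ (ExteriorAlgebra.ιMulti F m v) = _
  rw [ExteriorAlgebra.map_apply_ιMulti]
  rfl

lemma formEval_symExtRep {k : ℕ} {θ : Fin k → Fin n → MvPolynomial (Fin n) F} {g : GL (Fin n) F}
    (hθ : ∀ i, IsEquivariantRow g (θ i))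
    (ω : MvPolynomial (Fin n) F ⊗[F] ExteriorAlgebra F (Fin n → F)) :
    formEval θ (symExtRep F n g ω) = actHom g (formEval θ ω) := by
  have h : (formEval θ).restrictScalars F ∘ₗ symExtRep F n g
      = (actHom g).toLinearMap ∘ₗ (formEval θ).restrictScalars F := by
    refine tensor_hom_ext fun s m v => ?_
    simp only [LinearMap.comp_apply, LinearMap.restrictScalars_apply, AlgHom.toLinearMap_apply,
      symExtRep_tmul_ιMulti]
    by_cases hm : m = k
    · subst hm
      rw [formEval_tmul_ιMulti, formEval_tmul_ιMulti, map_mul, AlgHom.map_det]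
      congr 2
      ext1 i j
      exact ((hθ i).actHom_rowMap (v j)).symm
    · rw [formEval_tmul_ιMulti_of_ne hm, formEval_tmul_ιMulti_of_ne hm, map_zero]
  exact LinearMap.congr_fun h ω

lemma of_rowMap_update {k : ℕ} (θ : Fin k → Fin n → MvPolynomial (Fin n) F) (i : Fin k)
    (x : Fin n → MvPolynomial (Fin n) F) (v : Fin k → Fin n → F) :
    (Matrix.of fun i' j => rowMap (Function.update θ i x i') (v j))
      = (Matrix.of fun i' j => rowMap (θ i') (v j)).updateRow i fun j => rowMap x (v j) := by
  ext1 i' j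
  by_cases h : i' = i
  · subst h; simp
  · simp [h]

lemma formEval_update_add {k : ℕ} (θ : Fin k → Fin n → MvPolynomial (Fin n) F) (i : Fin k)
    (x y : Fin n → MvPolynomial (Fin n) F)
    (ω : MvPolynomial (Fin n) F ⊗[F] ExteriorAlgebra F (Fin n → F)) :
    formEval (Function.update θ i (x + y)) ω
      = formEval (Function.update θ i x) ω + formEval (Function.update θ i y) ω := by
  have h : (formEval (Function.update θ i (x + y))).restrictScalars F
      = (formEval (Function.update θ i x)).restrictScalars F
        + (formEval (Function.update θ i y)).restrictScalars F := by
    refine tensor_hom_ext fun s m v => ?_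
    simp only [LinearMap.add_apply, LinearMap.restrictScalars_apply]
    by_cases hm : m = k
    · subst hm
      have hv : (fun j => rowMap (x + y) (v j))
          = (fun j => rowMap x (v j)) + fun j => rowMap y (v j) :=
        funext fun j => rowMap_add x y (v j)
      simp only [formEval_tmul_ιMulti, of_rowMap_update, hv, Matrix.det_updateRow_add, mul_add]
    · simp only [formEval_tmul_ιMulti_of_ne hm, add_zero]
  exact LinearMap.congr_fun h ω

lemma formEval_update_smul {k : ℕ} (θ : Fin k → Fin n → MvPolynomial (Fin n) F) (i : Fin k)
    (c : MvPolynomial (Fin n) F) (x : Fin n → MvPolynomial (Fin n) F)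
    (ω : MvPolynomial (Fin n) F ⊗[F] ExteriorAlgebra F (Fin n → F)) :
    formEval (Function.update θ i (c • x)) ω = c * formEval (Function.update θ i x) ω := by
  have h : (formEval (Function.update θ i (c • x))).restrictScalars F
      = (c • formEval (Function.update θ i x)).restrictScalars F := by
    refine tensor_hom_ext fun s m v => ?_
    simp only [LinearMap.smul_apply, LinearMap.restrictScalars_apply]
    by_cases hm : m = k
    · subst hm
      have hv : (fun j => rowMap (c • x) (v j)) = c • fun j => rowMap x (v j) :=
        funext fun j => rowMap_smul c x (v j)
      rw [formEval_tmul_ιMulti, formEval_tmul_ιMulti, of_rowMap_update, of_rowMap_update, hv,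
        Matrix.det_updateRow_smul, smul_eq_mul, mul_left_comm]
    · simp only [formEval_tmul_ιMulti_of_ne hm, smul_zero]
  exact LinearMap.congr_fun h ω

lemma formEval_eq_zero_of_eq {k : ℕ} {θ : Fin k → Fin n → MvPolynomial (Fin n) F} {i i' : Fin k}
    (hθ : θ i = θ i') (hne : i ≠ i')
    (ω : MvPolynomial (Fin n) F ⊗[F] ExteriorAlgebra F (Fin n → F)) : formEval θ ω = 0 := by
  have h : (formEval θ).restrictScalars F = 0 := by
    refine tensor_hom_ext fun s m v => ?_
    simp only [LinearMap.zero_apply, LinearMap.restrictScalars_apply]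
    by_cases hm : m = k
    · subst hm
      rw [formEval_tmul_ιMulti, Matrix.det_zero_of_row_eq hne, mul_zero]
      ext1 j
      simp [hθ]
    · exact formEval_tmul_ιMulti_of_ne hm _ _ _
  exact LinearMap.congr_fun h ω

/-- An element of `S(V) ⊗ ∧(V)` as an alternating map on rows. -/
def formAlt (k : ℕ) (ω : MvPolynomial (Fin n) F ⊗[F] ExteriorAlgebra F (Fin n → F)) :
    (Fin n → MvPolynomial (Fin n) F) [⋀^Fin k]→ₗ[MvPolynomial (Fin n) F]
      MvPolynomial (Fin n) F where
  toFun θ := formEval θ ω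
  map_update_add' {inst} θ i x y := by
    obtain rfl : inst = instDecidableEqFin k := Subsingleton.elim _ _
    exact formEval_update_add θ i x y ω
  map_update_smul' {inst} θ i c x := by
    obtain rfl : inst = instDecidableEqFin k := Subsingleton.elim _ _
    exact formEval_update_smul θ i c x ω
  map_eq_zero_of_eq' θ i i' hθ hne := formEval_eq_zero_of_eq hθ hne ω

lemma formAlt_apply {k : ℕ} (ω : MvPolynomial (Fin n) F ⊗[F] ExteriorAlgebra F (Fin n → F))
    (θ : Fin k → Fin n → MvPolynomial (Fin n) F) : formAlt k ω θ = formEval θ ω := rfl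

/-- The increasing enumeration of a `k`-element set of indices. -/
abbrev enum {k : ℕ} (J : Set.powersetCard (Fin n) k) : Fin k ↪o Fin n :=
  Set.powersetCard.ofFinEmbEquiv.symm J

variable (F) in
/-- The standard basis vector `x_{j_1} ∧ ⋯ ∧ x_{j_k}` of the exterior power. -/
def wedge {k : ℕ} (J : Set.powersetCard (Fin n) k) : ⋀[F]^k (Fin n → F) :=
  (Pi.basisFun F (Fin n)).exteriorPower k J

variable (F) in
/-- The rows of the coordinate functionals with indices in `J`. -/
def stdRow {k : ℕ} (J : Set.powersetCard (Fin n) k) : Fin k → Fin n → MvPolynomial (Fin n) F :=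
  fun i => Pi.single (enum J i) 1

lemma formEval_stdRow_tmul {k : ℕ} (J : Set.powersetCard (Fin n) k)
    (s : MvPolynomial (Fin n) F) (x : ⋀[F]^k (Fin n → F)) :
    formEval (stdRow F J) (s ⊗ₜ (x : ExteriorAlgebra F (Fin n → F)))
      = ((Pi.basisFun F (Fin n)).exteriorPower k).repr x J • s := by
  have h : ((formEval (stdRow F J)).restrictScalars F ∘ₗ
      (TensorProduct.mk F _ _ s)) ∘ₗ (⋀[F]^k (Fin n → F)).subtype
      = (LinearMap.toSpanSingleton F _ s) ∘ₗ ((Pi.basisFun F (Fin n)).exteriorPower k).coord J := by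
    rw [exteriorPower.basis_coord]
    refine exteriorPower.linearMap_ext ?_
    ext1 v
    simp only [LinearMap.compAlternatingMap_apply, LinearMap.comp_apply,
      exteriorPower.ιMultiDual_apply_ιMulti, LinearMap.restrictScalars_apply,
      TensorProduct.mk_apply, Submodule.subtype_apply, exteriorPower.ιMulti_apply_coe,
      formEval_tmul_ιMulti, LinearMap.toSpanSingleton_apply]
    rw [Algebra.smul_def, mul_comm, RingHom.map_det, ← Matrix.det_transpose]
    congr 2
    ext1 i j
    simp [stdRow, rowMap_single_one]
  exact LinearMap.congr_fun h x

/-- The `k`-form with the given coefficients. -/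
def formOfCoeffs {k : ℕ} (c : Set.powersetCard (Fin n) k → MvPolynomial (Fin n) F) :
    MvPolynomial (Fin n) F ⊗[F] ExteriorAlgebra F (Fin n → F) :=
  ∑ J, c J ⊗ₜ (wedge F J : ExteriorAlgebra F (Fin n → F))

lemma formEval_stdRow_formOfCoeffs {k : ℕ}
    (c : Set.powersetCard (Fin n) k → MvPolynomial (Fin n) F) (J : Set.powersetCard (Fin n) k) :
    formEval (stdRow F J) (formOfCoeffs c) = c J := by
  classical
  simp only [formOfCoeffs, map_sum, formEval_stdRow_tmul, wedge, Module.Basis.repr_self,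
    Finsupp.single_apply, ite_smul, one_smul, zero_smul]
  simp

lemma formOfCoeffs_mem_bidegree {k i : ℕ}
    {c : Set.powersetCard (Fin n) k → MvPolynomial (Fin n) F} (hc : ∀ J, (c J).IsHomogeneous i) :
    formOfCoeffs c ∈ bidegree F n i k :=
  sum_mem fun J _ => ⟨⟨c J, hc J⟩ ⊗ₜ wedge F J, rfl⟩

lemma formOfCoeffs_formEval {k i : ℕ}
    {ω : MvPolynomial (Fin n) F ⊗[F] ExteriorAlgebra F (Fin n → F)} (hω : ω ∈ bidegree F n i k) :
    formOfCoeffs (fun J : Set.powersetCard (Fin n) k => formEval (stdRow F J) ω) = ω := by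
  obtain ⟨ω, rfl⟩ := hω
  induction ω using TensorProduct.induction_on with
  | zero => simp [formOfCoeffs]
  | tmul s x =>
    simp only [TensorProduct.map_tmul, Submodule.subtype_apply, formEval_stdRow_tmul, formOfCoeffs,
      TensorProduct.smul_tmul, ← TensorProduct.tmul_sum]
    congr 1
    conv_rhs => rw [← ((Pi.basisFun F (Fin n)).exteriorPower k).sum_repr x]
    simp [wedge]
  | add x y hx hy =>
    rw [map_add]
    conv_rhs => rw [← hx, ← hy]
    simp only [formOfCoeffs, map_add, TensorProduct.add_tmul, Finset.sum_add_distrib]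

lemma isHomogeneous_formEval_stdRow {k i : ℕ}
    {ω : MvPolynomial (Fin n) F ⊗[F] ExteriorAlgebra F (Fin n → F)} (hω : ω ∈ bidegree F n i k)
    (J : Set.powersetCard (Fin n) k) : (formEval (stdRow F J) ω).IsHomogeneous i := by
  obtain ⟨ω, rfl⟩ := hω
  induction ω using TensorProduct.induction_on with
  | zero => simpa using MvPolynomial.isHomogeneous_zero _ _ _
  | tmul s x =>
    rw [TensorProduct.map_tmul, Submodule.subtype_apply, Submodule.subtype_apply,
      formEval_stdRow_tmul]
    exact (MvPolynomial.homogeneousSubmodule (Fin n) F i).smul_mem _ s.2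
  | add x y hx hy =>
    rw [map_add, map_add]
    exact hx.add hy

lemma symExtRep_mem_bidegree (g : GL (Fin n) F) {k i : ℕ}
    {ω : MvPolynomial (Fin n) F ⊗[F] ExteriorAlgebra F (Fin n → F)} (hω : ω ∈ bidegree F n i k) :
    symExtRep F n g ω ∈ bidegree F n i k := by
  obtain ⟨ω, rfl⟩ := hω
  induction ω using TensorProduct.induction_on with
  | zero => simp
  | tmul s x =>
    refine ⟨⟨actHom g s, isHomogeneous_actHom g s.2⟩ ⊗ₜ exteriorPower.map k
      (Matrix.mulVecLin (g : Matrix (Fin n) (Fin n) F)) x, ?_⟩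
    have hx : ((exteriorPower.map k (Matrix.mulVecLin (g : Matrix (Fin n) (Fin n) F)) x :
        ⋀[F]^k (Fin n → F)) : ExteriorAlgebra F (Fin n → F))
          = ExteriorAlgebra.map (Matrix.mulVecLin (g : Matrix (Fin n) (Fin n) F)) x := by
      have h : (⋀[F]^k (Fin n → F)).subtype ∘ₗ exteriorPower.map k
          (Matrix.mulVecLin (g : Matrix (Fin n) (Fin n) F))
          = (ExteriorAlgebra.map (Matrix.mulVecLin
            (g : Matrix (Fin n) (Fin n) F))).toLinearMap ∘ₗ (⋀[F]^k (Fin n → F)).subtype := by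
        refine exteriorPower.linearMap_ext ?_
        ext1 v
        simp [exteriorPower.map_apply_ιMulti, ExteriorAlgebra.map_apply_ιMulti]
      exact LinearMap.congr_fun h x
    simp only [TensorProduct.map_tmul, Submodule.subtype_apply, hx]
    rfl
  | add x y hx hy =>
    rw [map_add, map_add]
    exact add_mem hx hy

/-- Alternating maps on rows are determined by their values on coordinate functionals. -/
lemma alternatingMap_ext_stdRow {k : ℕ}
    {α β : (Fin n → MvPolynomial (Fin n) F) [⋀^Fin k]→ₗ[MvPolynomial (Fin n) F]
      MvPolynomial (Fin n) F}
    (h : ∀ J, α (stdRow F J) = β (stdRow F J)) : α = β := by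
  apply exteriorPower.alternatingMapLinearEquiv.injective
  refine ((Pi.basisFun (MvPolynomial (Fin n) F) (Fin n)).exteriorPower k).ext fun J => ?_
  have hJ : (Pi.basisFun (MvPolynomial (Fin n) F) (Fin n)).exteriorPower k J
      = exteriorPower.ιMulti _ k (stdRow F J) := by
    rw [exteriorPower.basis_apply, exteriorPower.ιMulti_family]
    congr 1
    ext1 i
    simp [stdRow]
  rw [hJ, exteriorPower.alternatingMapLinearEquiv_apply_ιMulti,
    exteriorPower.alternatingMapLinearEquiv_apply_ιMulti, h J]

lemma formAlt_formOfCoeffs {k : ℕ}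
    (α : (Fin n → MvPolynomial (Fin n) F) [⋀^Fin k]→ₗ[MvPolynomial (Fin n) F]
      MvPolynomial (Fin n) F) :
    formAlt k (formOfCoeffs fun J => α (stdRow F J)) = α :=
  alternatingMap_ext_stdRow fun J => by
    rw [formAlt_apply, formEval_stdRow_formOfCoeffs]

/-- Rows with nonzero determinant suffice to detect alternating maps: up to the determinant, they
have the coordinate functionals in their span. -/
lemma alternatingMap_eq_zero_of_det_ne_zero {k : ℕ}
    {α : (Fin n → MvPolynomial (Fin n) F) [⋀^Fin k]→ₗ[MvPolynomial (Fin n) F]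
      MvPolynomial (Fin n) F} {θ : Matrix (Fin n) (Fin n) (MvPolynomial (Fin n) F)}
    (hdet : θ.det ≠ 0)
    (h : ∀ J : Set.powersetCard (Fin n) k, α (fun i => θ (enum J i)) = 0) : α = 0 := by
  have h1 : α.compLinearMap θ.vecMulLinear = 0 := by
    refine alternatingMap_ext_stdRow fun J => ?_
    rw [AlternatingMap.compLinearMap_apply, AlternatingMap.zero_apply, ← h J]
    congr 1
    ext1 i
    simp [stdRow]
    rfl
  refine AlternatingMap.ext fun φ => ?_
  have h2 := congrArg (fun β => β fun i => Matrix.vecMulLinear θ.adjugate (φ i)) h1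
  simp only [AlternatingMap.compLinearMap_apply, Matrix.vecMulLinear_apply, Matrix.vecMul_vecMul,
    Matrix.adjugate_mul, Matrix.vecMul_smul, Matrix.vecMul_one, AlternatingMap.zero_apply] at h2
  rw [AlternatingMap.map_smul_univ] at h2
  rw [AlternatingMap.zero_apply]
  refine (smul_eq_zero.1 h2).resolve_left ?_
  simpa using pow_ne_zero k hdet

end Forms

/-! ### Equivariant rows and their dual forms -/

section DualForms

variable {F : Type*} [Field F] [Fintype F] {n : ℕ} (I : Composition n)

local notation "q" => Fintype.card F

variable (F) in
/-- The `F`-linear operator `y ↦ (∏ (y - v)) ^ (q ^ (r - m))`, with the product over the linear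
forms `v` in the variables before the block of `r`, and `m` the number of these variables. -/
def dualMap (r : Fin n) : MvPolynomial (Fin n) F →ₗ[F] MvPolynomial (Fin n) F :=
  (FiniteField.frobeniusAlgHom F (MvPolynomial (Fin n) F) ^ ((r : ℕ) - blockStart I r)).toLinearMap
    ∘ₗ flagMap F n (blockStart I r)

lemma dualMap_apply (r : Fin n) (y : MvPolynomial (Fin n) F) :
    dualMap F I r y = flagMap F n (blockStart I r) y ^ q ^ ((r : ℕ) - blockStart I r) := by
  rw [dualMap, LinearMap.comp_apply, AlgHom.toLinearMap_apply, AlgHom.coe_pow,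
    FiniteField.coe_frobeniusAlgHom, pow_iterate]

variable (F) in
/-- The matrix of the values of the operators `dualMap` on the variables. Its rows commute with
the parabolic subgroup, so they evaluate invariant forms to invariant polynomials. -/
def dualRow : Matrix (Fin n) (Fin n) (MvPolynomial (Fin n) F) :=
  Matrix.of fun r j => dualMap F I r (MvPolynomial.X j)

lemma dualRow_apply (r j : Fin n) : dualRow F I r j = dualMap F I r (MvPolynomial.X j) := rfl

lemma rowMap_dualRow (r : Fin n) (v : Fin n → F) :
    rowMap (dualRow F I r) v = dualMap F I r (lin v) := by
  simp [rowMap_apply, lin, Fintype.linearCombination_apply, dualRow_apply]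

lemma dualRow_eq_zero {r j : Fin n} (h : (j : ℕ) < blockStart I r) : dualRow F I r j = 0 := by
  rw [dualRow_apply, dualMap_apply, flagMap_X_eq_zero h,
    zero_pow (pow_ne_zero _ Fintype.card_ne_zero)]

lemma isHomogeneous_dualRow (r j : Fin n) : (dualRow F I r j).IsHomogeneous (q ^ (r : ℕ)) := by
  rw [dualRow_apply, dualMap_apply]
  have h := (isHomogeneous_flagMap (blockStart I r) (MvPolynomial.isHomogeneous_X F j)).pow
    (q ^ ((r : ℕ) - blockStart I r))
  rwa [← pow_add, Nat.add_sub_cancel' (blockStart_le I r)] at h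

lemma X_dvd_dualRow (r j : Fin n) : MvPolynomial.X j ∣ dualRow F I r j := by
  rw [dualRow_apply, dualMap_apply]
  exact (dvd_flagMap _ _).trans (dvd_pow_self _ (pow_ne_zero _ Fintype.card_ne_zero))

variable {I} in
lemma isEquivariantRow_dualRow {g : GL (Fin n) F} (hg : g ∈ parabolic F I) (r : Fin n) :
    IsEquivariantRow g (dualRow F I r) := by
  intro j
  rw [rowMap_dualRow, dualRow_apply, dualMap_apply, dualMap_apply, map_pow,
    actHom_flagMap (isBlockBoundary_blockStart I r) hg, actHom_X]

lemma flagMap_pow_eq (m t : ℕ) : ∃ c : ℕ → MvPolynomial (Fin n) F, ∀ y,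
    flagMap F n m y ^ q ^ t
      = flagMap F n (m + t) y + ∑ s ∈ Finset.range (m + t), c s * flagMap F n s y := by
  induction t with
  | zero => exact ⟨0, fun y => by simp⟩
  | succ t ih =>
    obtain ⟨c, hc⟩ := ih
    have hfrob : ∀ s y, flagMap F n s y ^ q = flagMap F n (s + 1) y
        + flagMap F n s (flagVar F n s) ^ (q - 1) * flagMap F n s y := fun s y => by
      rw [flagMap_succ, sub_add_cancel]
    have hpow : ∀ x : MvPolynomial (Fin n) F, x ^ q = FiniteField.frobeniusAlgHom F _ x :=
      fun x => rfl
    -- both sums that arise are sums over `range (m + t + 1)`, after padding with zeros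
    let c₁ : ℕ → MvPolynomial (Fin n) F := fun s => if s = 0 then 0 else c (s - 1) ^ q
    let c₂ : ℕ → MvPolynomial (Fin n) F := fun s =>
      (if s = m + t then 1 else c s ^ q) * flagMap F n s (flagVar F n s) ^ (q - 1)
    refine ⟨c₁ + c₂, fun y => ?_⟩
    rw [pow_succ, pow_mul, hc, hpow, map_add, map_sum, ← hpow, hfrob]
    simp only [Pi.add_apply, add_mul, Finset.sum_add_distrib]
    have h1 : ∑ s ∈ Finset.range (m + (t + 1)), c₁ s * flagMap F n s y
        = ∑ s ∈ Finset.range (m + t), c s ^ q * flagMap F n (s + 1) y := by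
      rw [← add_assoc, Finset.sum_range_succ']
      simp [c₁]
    have h2 : ∑ s ∈ Finset.range (m + (t + 1)), c₂ s * flagMap F n s y
        = (∑ s ∈ Finset.range (m + t),
            c s ^ q * (flagMap F n s (flagVar F n s) ^ (q - 1) * flagMap F n s y))
          + flagMap F n (m + t) (flagVar F n (m + t)) ^ (q - 1) * flagMap F n (m + t) y := by
      rw [← add_assoc, Finset.sum_range_succ]
      congr 1
      · refine Finset.sum_congr rfl fun s hs => ?_
        have : s ≠ m + t := (Finset.mem_range.1 hs).ne
        simp only [c₂, if_neg this, mul_assoc]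
      · simp [c₂]
    have h3 : ∑ s ∈ Finset.range (m + t), FiniteField.frobeniusAlgHom F _ (c s * flagMap F n s y)
        = (∑ s ∈ Finset.range (m + t), c s ^ q * flagMap F n (s + 1) y)
          + ∑ s ∈ Finset.range (m + t),
            c s ^ q * (flagMap F n s (flagVar F n s) ^ (q - 1) * flagMap F n s y) := by
      rw [← Finset.sum_add_distrib]
      refine Finset.sum_congr rfl fun s _ => ?_
      rw [← hpow, mul_pow, hfrob, mul_add]
    rw [h1, h2, h3, ← add_assoc m t 1]
    ring

lemma exists_dualMap_eq (r : Fin n) : ∃ c : ℕ → MvPolynomial (Fin n) F, ∀ y,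
    dualMap F I r y = flagMap F n r y + ∑ s ∈ Finset.range r, c s * flagMap F n s y := by
  obtain ⟨c, hc⟩ := flagMap_pow_eq (F := F) (n := n) (blockStart I r) (r - blockStart I r)
  rw [Nat.add_sub_cancel' (blockStart_le I r)] at hc
  exact ⟨c, fun y => by rw [dualMap_apply, hc]⟩

omit [Fintype F] in
variable (F) in
/-- The projection of rows that keeps the first `m` columns. -/
def maskRow (m : ℕ) : (Fin n → MvPolynomial (Fin n) F) →ₗ[MvPolynomial (Fin n) F]
    (Fin n → MvPolynomial (Fin n) F) :=
  LinearMap.pi fun j => if (j : ℕ) < m then LinearMap.proj j else 0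

omit [Fintype F] in
lemma maskRow_apply (m : ℕ) (φ : Fin n → MvPolynomial (Fin n) F) (j : Fin n) :
    maskRow F m φ j = if (j : ℕ) < m then φ j else 0 := by
  simp only [maskRow, LinearMap.pi_apply]
  split_ifs <;> rfl

variable (F) in
/-- The upper left `m × m` block of `dualRow`, completed by an identity block. -/
def cornerRow (m : ℕ) : Matrix (Fin n) (Fin n) (MvPolynomial (Fin n) F) :=
  Matrix.of fun r => if (r : ℕ) < m then maskRow F m (dualRow F I r) else Pi.single r 1

lemma cornerRow_of_lt {m : ℕ} {r : Fin n} (h : (r : ℕ) < m) :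
    cornerRow F I m r = maskRow F m (dualRow F I r) := if_pos h

lemma cornerRow_of_le {m : ℕ} {r : Fin n} (h : m ≤ (r : ℕ)) :
    cornerRow F I m r = Pi.single r 1 := if_neg (not_lt.2 h)

/-- By unitriangular row operations `cornerRow` is transformed into an upper triangular matrix. -/
lemma det_cornerRow {m : ℕ} (hm : m ≤ n) : (cornerRow F I m).det = mooreProd F n m := by
  choose c hc using exists_dualMap_eq (F := F) I
  let U : Matrix (Fin n) (Fin n) (MvPolynomial (Fin n) F) := Matrix.of fun r s =>
    if r = s then 1 else if s < r ∧ (r : ℕ) < m then c r s else 0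
  let T : Matrix (Fin n) (Fin n) (MvPolynomial (Fin n) F) := Matrix.of fun r =>
    if (r : ℕ) < m then maskRow F m (fun j => flagMap F n r (MvPolynomial.X j)) else Pi.single r 1
  have hUT : cornerRow F I m = U * T := by
    ext1 r j
    rw [Matrix.mul_apply]
    rcases lt_or_ge (r : ℕ) m with hr | hr
    · have h1 : ∀ s, U r s * T s j = (if r = s then T s j else 0)
          + if (s : ℕ) < r then (if (j : ℕ) < m then
              c r s * flagMap F n s (MvPolynomial.X j) else 0) else 0 := fun s => by
        rcases lt_trichotomy s r with h | h | h
        · have hs : (s : ℕ) < m := lt_trans h hr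
          have h' : (s : ℕ) < r := h
          simp [U, T, h, h.ne', hr, hs, h', maskRow_apply]
        · simp [U, h]
        · have h' : ¬ (s : ℕ) < r := not_lt.2 (le_of_lt h)
          simp [U, h.ne, h.not_gt, h']
      rw [Finset.sum_congr rfl fun s _ => h1 s, Finset.sum_add_distrib, Finset.sum_ite_eq,
        if_pos (Finset.mem_univ r), Fin.sum_univ_eq_sum_range fun s => if s < (r : ℕ) then
          (if (j : ℕ) < m then c r s * flagMap F n s (MvPolynomial.X j) else 0) else 0,
        ← Finset.sum_filter, cornerRow_of_lt I hr, maskRow_apply, dualRow_apply, hc]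
      have h2 : (Finset.range n).filter (fun s => s < (r : ℕ)) = Finset.range r := by
        ext s
        have := r.2
        simp only [Finset.mem_filter, Finset.mem_range]
        omega
      rw [h2]
      simp only [T, Matrix.of_apply, if_pos hr, maskRow_apply]
      split_ifs <;> simp
    · have h1 : ∀ s, U r s * T s j = if r = s then T s j else 0 := fun s => by
        simp [U, not_lt.2 hr]
      rw [Finset.sum_congr rfl fun s _ => h1 s, Finset.sum_ite_eq, if_pos (Finset.mem_univ r),
        cornerRow_of_le I hr]
      simp only [T, Matrix.of_apply, if_neg (not_lt.2 hr)]
  have hU : U.det = 1 := by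
    rw [Matrix.det_of_isLowerTriangular]
    · simp [U]
    · intro r s hrs
      have hrs' : r < s := hrs
      simp [U, hrs'.ne, hrs'.le]
  have hT : T.det = mooreProd F n m := by
    rw [Matrix.det_of_isUpperTriangular]
    · have h1 : ∀ r : Fin n, T r r
          = if (r : ℕ) < m then flagMap F n r (flagVar F n r) else 1 := fun r => by
        rw [flagVar_val]
        by_cases h : (r : ℕ) < m <;> simp [T, h, maskRow_apply]
      rw [Finset.prod_congr rfl fun r _ => h1 r, Fin.prod_univ_eq_prod_range fun r =>
        if r < m then flagMap F n r (flagVar F n r) else 1, ← Finset.prod_filter, mooreProd]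
      congr 1
      ext r
      simp only [Finset.mem_filter, Finset.mem_range]
      omega
    · intro r s hrs
      have hrs' : s < r := hrs
      simp only [T, Matrix.of_apply]
      split_ifs with h
      · rw [maskRow_apply, flagMap_X_eq_zero hrs', ite_self]
      · exact Pi.single_eq_of_ne hrs'.ne _
  rw [hUT, Matrix.det_mul, hU, hT, one_mul]

lemma det_dualRow_ne_zero : (dualRow F I).det ≠ 0 := by
  have h : cornerRow F I n = dualRow F I := by
    ext1 r j
    rw [cornerRow_of_lt I r.2, maskRow_apply, if_pos j.2]
  rw [← h, det_cornerRow I le_rfl]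
  exact mooreProd_ne_zero le_rfl

/-- The end of the last block that meets `B`. -/
def topEnd (B : Finset (Fin n)) : ℕ := B.sup (blockEnd I)

omit [Fintype F] in
lemma isBlockBoundary_topEnd (B : Finset (Fin n)) : IsBlockBoundary I (topEnd I B) := by
  refine ⟨Finset.sup_le fun b _ => blockEnd_le I b, fun k hk => ?_⟩
  obtain ⟨b, hb, h⟩ := Finset.lt_sup_iff.1 hk
  exact (blockEnd_mono I h).trans (Finset.le_sup (f := blockEnd I) hb)

lemma lt_topEnd {B : Finset (Fin n)} {b : Fin n} (hb : b ∈ B) : (b : ℕ) < topEnd I B :=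
  (lt_blockEnd I b).trans_le (Finset.le_sup (f := blockEnd I) hb)

lemma topEnd_le_blockStart {B : Finset (Fin n)} {s : Fin n} (h : topEnd I B ≤ s) :
    topEnd I B ≤ blockStart I s :=
  Finset.sup_le fun _ hb =>
    (blockEnd_le_iff I).1 ((Finset.le_sup (f := blockEnd I) hb).trans h)

/-- The matrix `M` with the rows in `B` replaced by `φ`. -/
def replaceRows {k : ℕ} (B : Set.powersetCard (Fin n) k) (φ : Fin k → Fin n → MvPolynomial (Fin n) F)
    (M : Matrix (Fin n) (Fin n) (MvPolynomial (Fin n) F)) :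
    Matrix (Fin n) (Fin n) (MvPolynomial (Fin n) F) :=
  Matrix.of (Function.extend (enum B) φ fun r => M r)

omit [Fintype F] in
lemma enum_mem {k : ℕ} (B : Set.powersetCard (Fin n) k) (i : Fin k) :
    enum B i ∈ (B : Finset (Fin n)) :=
  (Set.powersetCard.mem_range_ofFinEmbEquiv_symm_iff_mem B _).1 ⟨i, rfl⟩

omit [Fintype F] in
lemma exists_enum_eq {k : ℕ} {B : Set.powersetCard (Fin n) k} {r : Fin n}
    (h : r ∈ (B : Finset (Fin n))) : ∃ i, enum B i = r :=
  (Set.powersetCard.mem_range_ofFinEmbEquiv_symm_iff_mem B _).2 h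

omit [Fintype F] in
lemma replaceRows_enum {k : ℕ} (B : Set.powersetCard (Fin n) k)
    (φ : Fin k → Fin n → MvPolynomial (Fin n) F)
    (M : Matrix (Fin n) (Fin n) (MvPolynomial (Fin n) F)) (i : Fin k) :
    replaceRows B φ M (enum B i) = φ i :=
  (enum B).injective.extend_apply _ _ i

omit [Fintype F] in
lemma replaceRows_of_notMem {k : ℕ} {B : Set.powersetCard (Fin n) k}
    (φ : Fin k → Fin n → MvPolynomial (Fin n) F)
    (M : Matrix (Fin n) (Fin n) (MvPolynomial (Fin n) F)) {r : Fin n}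
    (hr : r ∉ (B : Finset (Fin n))) : replaceRows B φ M r = M r :=
  Function.extend_apply' _ _ _ (by rintro ⟨i, rfl⟩; exact hr (enum_mem B i))

omit [Fintype F] in
lemma replaceRows_update {k : ℕ} (B : Set.powersetCard (Fin n) k)
    (φ : Fin k → Fin n → MvPolynomial (Fin n) F)
    (M : Matrix (Fin n) (Fin n) (MvPolynomial (Fin n) F)) (i : Fin k)
    (x : Fin n → MvPolynomial (Fin n) F) :
    replaceRows B (Function.update φ i x) M = (replaceRows B φ M).updateRow (enum B i) x := by
  ext1 r c
  rw [Matrix.updateRow_apply]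
  by_cases hr : r ∈ (B : Finset (Fin n))
  · obtain ⟨j, rfl⟩ := exists_enum_eq hr
    rw [replaceRows_enum, replaceRows_enum, Function.update_apply]
    simp only [(enum B).injective.eq_iff]
    split_ifs <;> rfl
  · have h : r ≠ enum B i := by rintro rfl; exact hr (enum_mem B i)
    rw [replaceRows_of_notMem _ _ hr, replaceRows_of_notMem _ _ hr, if_neg h]

lemma comp_update_linearMap {R M N : Type*} [Semiring R] [AddCommMonoid M] [AddCommMonoid N]
    [Module R M] [Module R N] {k : ℕ} (f : M →ₗ[R] N) (φ : Fin k → M) (i : Fin k) (x : M) :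
    (fun j => f (Function.update φ i x j)) = Function.update (fun j => f (φ j)) i (f x) :=
  Function.comp_update f φ i x

variable (F) in
/-- The alternating map that puts its arguments in the rows `B` of `cornerRow` and takes the
determinant. -/
def cornerAlt {k : ℕ} (B : Set.powersetCard (Fin n) k) :
    (Fin n → MvPolynomial (Fin n) F) [⋀^Fin k]→ₗ[MvPolynomial (Fin n) F]
      MvPolynomial (Fin n) F where
  toFun φ := (replaceRows B (fun i => maskRow F (topEnd I B) (φ i))
    (cornerRow F I (topEnd I B))).det
  map_update_add' {inst} φ i x y := by
    obtain rfl : inst = instDecidableEqFin k := Subsingleton.elim _ _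
    simp only [comp_update_linearMap, replaceRows_update, map_add, Matrix.det_updateRow_add]
  map_update_smul' {inst} φ i c x := by
    obtain rfl : inst = instDecidableEqFin k := Subsingleton.elim _ _
    simp only [comp_update_linearMap, replaceRows_update, map_smul, Matrix.det_updateRow_smul,
      smul_eq_mul]
  map_eq_zero_of_eq' φ i i' hφ hne := by
    refine Matrix.det_zero_of_row_eq ((enum B).injective.ne hne) ?_
    rw [replaceRows_enum, replaceRows_enum, hφ]

variable (F) in
/-- The rows of `dualRow` with indices in `B`. -/
def dualRows {k : ℕ} (B : Set.powersetCard (Fin n) k) : Fin k → Fin n → MvPolynomial (Fin n) F :=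
  fun i => dualRow F I (enum B i)

lemma cornerAlt_dualRows_self {k : ℕ} (B : Set.powersetCard (Fin n) k) :
    cornerAlt F I B (dualRows F I B) = mooreProd F n (topEnd I B) := by
  rw [← det_cornerRow I (isBlockBoundary_topEnd I B).1]
  refine congrArg Matrix.det (funext fun r => ?_)
  by_cases hr : r ∈ (B : Finset (Fin n))
  · obtain ⟨i, rfl⟩ := exists_enum_eq hr
    rw [replaceRows_enum, cornerRow_of_lt I (lt_topEnd I hr)]
    rfl
  · rw [replaceRows_of_notMem _ _ hr]

/-- For `s ∈ B' \ B` the row `s` occurs twice, or it is masked to zero. -/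
lemma cornerAlt_dualRows_of_ne {k : ℕ} {B B' : Set.powersetCard (Fin n) k} (h : B' ≠ B) :
    cornerAlt F I B (dualRows F I B') = 0 := by
  obtain ⟨s, hs', hs⟩ := (Set.powersetCard.exists_mem_notMem_iff_ne B' B).1 h
  obtain ⟨i, rfl⟩ := exists_enum_eq hs'
  rcases lt_or_ge (enum B' i : ℕ) (topEnd I B) with hlt | hge
  · refine Matrix.det_zero_of_row_eq (i := enum B i) (j := enum B' i)
      (fun hj => hs (hj ▸ enum_mem B i)) ?_
    rw [replaceRows_enum, replaceRows_of_notMem _ _ hs, cornerRow_of_lt I hlt]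
    rfl
  · refine Matrix.det_eq_zero_of_row_eq_zero (enum B i) fun j => ?_
    rw [replaceRows_enum, maskRow_apply]
    split_ifs with hj
    · exact dualRow_eq_zero I (hj.trans_le (topEnd_le_blockStart I hge))
    · rfl

omit [Fintype F] in
lemma isHomogeneous_det {ι : Type*} [Fintype ι] [DecidableEq ι]
    {M : Matrix ι ι (MvPolynomial (Fin n) F)} {d : ι → ℕ}
    (h : ∀ r j, (M r j).IsHomogeneous (d r)) : M.det.IsHomogeneous (∑ r, d r) := by
  rw [← Matrix.det_transpose, Matrix.det_apply]
  refine MvPolynomial.IsHomogeneous.sum _ _ _ fun σ _ => ?_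
  rw [Units.smul_def]
  exact zsmul_mem (K := MvPolynomial.homogeneousSubmodule (Fin n) F _)
    (MvPolynomial.IsHomogeneous.prod _ _ _ fun r _ => h r (σ r)) _

/-- The polynomial degree of the basis form with index `B`. -/
def formWeight (Q : ℕ) (B : Finset (Fin n)) : ℕ :=
  Q ^ topEnd I B - 1 - ∑ b ∈ B, Q ^ (b : ℕ)

omit [Fintype F] in
lemma sum_range_topEnd_eq (Q : ℕ) (B : Finset (Fin n)) :
    ∑ k ∈ Finset.range (topEnd I B), Q ^ k = (∑ b ∈ B, Q ^ (b : ℕ))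
      + ∑ r : Fin n, if r ∈ B then 0 else if (r : ℕ) < topEnd I B then Q ^ (r : ℕ) else 0 := by
  have h1 : ∑ k ∈ Finset.range (topEnd I B), Q ^ k
      = ∑ r : Fin n, if (r : ℕ) < topEnd I B then Q ^ (r : ℕ) else 0 := by
    rw [Fin.sum_univ_eq_sum_range fun k => if k < topEnd I B then Q ^ k else 0,
      ← Finset.sum_filter]
    congr 1
    ext k
    have := (isBlockBoundary_topEnd I B).1
    simp only [Finset.mem_range, Finset.mem_filter]
    omega
  have h2 : ∑ b ∈ B, Q ^ (b : ℕ) = ∑ r : Fin n, if r ∈ B then Q ^ (r : ℕ) else 0 := by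
    simp
  rw [h1, h2, ← Finset.sum_add_distrib]
  refine Finset.sum_congr rfl fun r _ => ?_
  by_cases hr : r ∈ B
  · simp [hr, lt_topEnd I hr]
  · simp [hr]

omit [Fintype F] in
lemma sub_one_mul_sum_range (Q m : ℕ) (hQ : 1 < Q) :
    (Q - 1) * ∑ k ∈ Finset.range m, Q ^ k = Q ^ m - 1 := by
  have h := geom_sum_mul_add (Q - 1) m
  rw [Nat.sub_add_cancel hQ.le] at h
  rw [mul_comm, ← h, Nat.add_sub_cancel]

lemma formWeight_add (Q : ℕ) (hQ : 1 < Q) (B : Finset (Fin n)) :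
    formWeight I Q B + ∑ b ∈ B, Q ^ (b : ℕ) = Q ^ topEnd I B - 1 := by
  have h1 := sum_range_topEnd_eq I Q B
  have h2 := sub_one_mul_sum_range Q (topEnd I B) hQ
  have h3 : ∑ k ∈ Finset.range (topEnd I B), Q ^ k
      ≤ (Q - 1) * ∑ k ∈ Finset.range (topEnd I B), Q ^ k :=
    Nat.le_mul_of_pos_left _ (by omega)
  unfold formWeight
  omega

variable (F) in
/-- The coefficient of the basis form with index `B`; it is dual to `dualRows` up to the factor
`mooreProd ^ (q - 1)`. -/
def basisAlt {k : ℕ} (B : Set.powersetCard (Fin n) k) :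
    (Fin n → MvPolynomial (Fin n) F) [⋀^Fin k]→ₗ[MvPolynomial (Fin n) F]
      MvPolynomial (Fin n) F :=
  mooreProd F n (topEnd I B) ^ (q - 2) • cornerAlt F I B

variable (F) in
/-- The basis form of `(S(V) ⊗ ∧(V))^{P_I}` over `S(V)^{P_I}` with index `B`. -/
def basisForm {k : ℕ} (B : Set.powersetCard (Fin n) k) :
    MvPolynomial (Fin n) F ⊗[F] ExteriorAlgebra F (Fin n → F) :=
  formOfCoeffs fun J => basisAlt F I B (stdRow F J)

lemma formEval_dualRows_basisForm {k : ℕ} (B B' : Set.powersetCard (Fin n) k) :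
    formEval (dualRows F I B') (basisForm F I B)
      = if B' = B then mooreProd F n (topEnd I B) ^ (q - 1) else 0 := by
  rw [← formAlt_apply, basisForm, formAlt_formOfCoeffs, basisAlt, AlternatingMap.smul_apply,
    smul_eq_mul]
  split_ifs with h
  · subst h
    have h1 := one_lt_q (F := F)
    rw [cornerAlt_dualRows_self, ← pow_succ]
    congr 1
    omega
  · rw [cornerAlt_dualRows_of_ne I h, mul_zero]

lemma isHomogeneous_basisAlt_stdRow {k : ℕ} (B J : Set.powersetCard (Fin n) k) :
    (basisAlt F I B (stdRow F J)).IsHomogeneous (formWeight I q B) := by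
  have h1 := one_lt_q (F := F)
  have hdeg : formWeight I q B = (∑ k ∈ Finset.range (topEnd I B), q ^ k) * (q - 2)
      + ∑ r : Fin n, if r ∈ (B : Finset (Fin n)) then 0 else
        if (r : ℕ) < topEnd I B then q ^ (r : ℕ) else 0 := by
    have h2 := sum_range_topEnd_eq I q B
    have h3 := sub_one_mul_sum_range q (topEnd I B) h1
    have h4 := formWeight_add I q h1 B
    obtain ⟨c, hc⟩ : ∃ c, q = c + 2 := ⟨q - 2, by omega⟩
    have h5 : q - 1 = (q - 2) + 1 := by omega
    rw [h5, add_mul, one_mul, mul_comm] at h3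
    omega
  rw [hdeg, basisAlt, AlternatingMap.smul_apply, smul_eq_mul]
  refine ((isHomogeneous_mooreProd _).pow _).mul (isHomogeneous_det fun r j => ?_)
  by_cases hr : r ∈ (B : Finset (Fin n))
  · obtain ⟨i, rfl⟩ := exists_enum_eq hr
    rw [if_pos hr, replaceRows_enum, maskRow_apply]
    split_ifs
    · rw [stdRow, Pi.single_apply]
      split_ifs
      · exact MvPolynomial.isHomogeneous_one _ _
      · exact MvPolynomial.isHomogeneous_zero _ _ _
    · exact MvPolynomial.isHomogeneous_zero _ _ _
  · rw [if_neg hr, replaceRows_of_notMem _ _ hr]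
    rcases lt_or_ge (r : ℕ) (topEnd I B) with h | h
    · rw [if_pos h, cornerRow_of_lt I h, maskRow_apply]
      split_ifs
      · exact isHomogeneous_dualRow I r j
      · exact MvPolynomial.isHomogeneous_zero _ _ _
    · rw [if_neg (not_lt.2 h), cornerRow_of_le I h, Pi.single_apply]
      split_ifs
      · exact MvPolynomial.isHomogeneous_one _ _
      · exact MvPolynomial.isHomogeneous_zero _ _ _

lemma basisForm_mem_bidegree {k : ℕ} (B : Set.powersetCard (Fin n) k) :
    basisForm F I B ∈ bidegree F n (formWeight I q B) k :=
  formOfCoeffs_mem_bidegree (isHomogeneous_basisAlt_stdRow I B)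

/-- The values on the rows `dualRow` determine a form. -/
lemma eq_zero_of_formEval_dualRows {k i : ℕ}
    {ω : MvPolynomial (Fin n) F ⊗[F] ExteriorAlgebra F (Fin n → F)} (hω : ω ∈ bidegree F n i k)
    (h : ∀ B : Set.powersetCard (Fin n) k, formEval (dualRows F I B) ω = 0) : ω = 0 := by
  have h0 : formAlt k ω = 0 := alternatingMap_eq_zero_of_det_ne_zero (det_dualRow_ne_zero I) h
  rw [← formOfCoeffs_formEval hω]
  refine Finset.sum_eq_zero fun J _ => ?_
  simp only [← formAlt_apply, h0, AlternatingMap.zero_apply, TensorProduct.zero_tmul]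

variable {I} in
lemma formEval_dualRows_symExtRep {k : ℕ} {g : GL (Fin n) F} (hg : g ∈ parabolic F I)
    (B : Set.powersetCard (Fin n) k)
    (ω : MvPolynomial (Fin n) F ⊗[F] ExteriorAlgebra F (Fin n → F)) :
    formEval (dualRows F I B) (symExtRep F n g ω) = actHom g (formEval (dualRows F I B) ω) :=
  formEval_symExtRep (fun _ => isEquivariantRow_dualRow hg _) ω

lemma formEval_dualRows_mem_symInvariants {k : ℕ}
    {ω : MvPolynomial (Fin n) F ⊗[F] ExteriorAlgebra F (Fin n → F)}
    (hω : ω ∈ parabolicInvariants F I) (B : Set.powersetCard (Fin n) k) :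
    formEval (dualRows F I B) ω ∈ symInvariants F I := fun g hg => by
  rw [← formEval_dualRows_symExtRep hg]
  congr 1
  exact hω ⟨g, hg⟩

/-- A form is invariant as soon as its values on the rows `dualRow` are. -/
lemma mem_parabolicInvariants_of_formEval {k i : ℕ}
    {ω : MvPolynomial (Fin n) F ⊗[F] ExteriorAlgebra F (Fin n → F)} (hω : ω ∈ bidegree F n i k)
    (h : ∀ B : Set.powersetCard (Fin n) k, formEval (dualRows F I B) ω ∈ symInvariants F I) :
    ω ∈ parabolicInvariants F I := by
  rintro ⟨g, hg⟩
  change symExtRep F n g ω = ω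
  rw [← sub_eq_zero]
  refine eq_zero_of_formEval_dualRows I (sub_mem (symExtRep_mem_bidegree g hω) hω) fun B => ?_
  rw [map_sub, formEval_dualRows_symExtRep hg, h B g hg, sub_self]

lemma isHomogeneous_formEval_dualRows {k i : ℕ}
    {ω : MvPolynomial (Fin n) F ⊗[F] ExteriorAlgebra F (Fin n → F)} (hω : ω ∈ bidegree F n i k)
    (B : Set.powersetCard (Fin n) k) :
    (formEval (dualRows F I B) ω).IsHomogeneous
      (i + ∑ b ∈ (B : Finset (Fin n)), q ^ (b : ℕ)) := by
  have hB : (B : Finset (Fin n)) = Finset.univ.image (enum B) := by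
    ext r
    simp only [Finset.mem_image, Finset.mem_univ, true_and]
    exact ⟨exists_enum_eq, by rintro ⟨j, rfl⟩; exact enum_mem B j⟩
  rw [hB, Finset.sum_image (enum B).injective.injOn, ← formOfCoeffs_formEval hω, formOfCoeffs,
    map_sum]
  refine MvPolynomial.IsHomogeneous.sum _ _ _ fun J _ => ?_
  have hJ : (wedge F J : ExteriorAlgebra F (Fin n → F))
      = ExteriorAlgebra.ιMulti F k (fun i => Pi.basisFun F (Fin n) (enum J i)) := by
    rw [wedge, exteriorPower.basis_apply, exteriorPower.ιMulti_family_apply_coe]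
    rfl
  rw [hJ, formEval_tmul_ιMulti]
  refine (isHomogeneous_formEval_stdRow hω J).mul (isHomogeneous_det fun a j => ?_)
  rw [Matrix.of_apply, Pi.basisFun_apply, rowMap_single]
  exact isHomogeneous_dualRow I _ _

end DualForms

/-! ### Exponents in polynomials invariant under transvections and dilations -/

section Exponents

variable {F : Type*} [Field F] [Fintype F] {n : ℕ}

local notation "q" => Fintype.card F

/-- A polynomial invariant under the translations by `F • t` is a polynomial in
`X ^ q - t ^ (q - 1) X`, so modulo `t` it is a polynomial in `X ^ q`. -/
lemma dvd_coeff_of_comp_eq {R : Type*} [CommRing R] [IsDomain R] [Algebra F R] {t : R}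
    (ht : t ≠ 0) (f : Polynomial R)
    (hf : ∀ c : F, f.comp (Polynomial.X + Polynomial.C (c • t)) = f) (i : ℕ) (hi : ¬ q ∣ i) :
    t ∣ f.coeff i := by
  have hq := one_lt_q (F := F)
  have hfrob : ∀ x y : Polynomial R, (x + y) ^ q = x ^ q + y ^ q := fun x y =>
    map_add (FiniteField.frobeniusAlgHom F (Polynomial R)) x y
  have hct : ∀ c : F, (c • t) ^ q = t ^ (q - 1) * (c • t) := fun c => by
    rw [smul_pow, FiniteField.pow_card, mul_smul_comm, ← pow_succ, Nat.sub_add_cancel hq.le]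
  let N : Polynomial R := Polynomial.X ^ q - Polynomial.C (t ^ (q - 1)) * Polynomial.X
  have hdeg : (Polynomial.C (t ^ (q - 1)) * Polynomial.X).degree < (q : WithBot ℕ) :=
    (Polynomial.degree_C_mul_X_le _).trans_lt (by exact_mod_cast hq)
  have hN : N.Monic := Polynomial.monic_X_pow_sub hdeg
  have hNd : N.natDegree = q := by
    exact (Polynomial.natDegree_sub_eq_left_of_natDegree_lt
      ((Polynomial.natDegree_C_mul_le _ _).trans_lt
        (by rwa [Polynomial.natDegree_X, Polynomial.natDegree_X_pow]))).trans
      (Polynomial.natDegree_X_pow _)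
  have hNc : ∀ c : F, N.comp (Polynomial.X + Polynomial.C (c • t)) = N := fun c => by
    simp only [N, Polynomial.sub_comp, Polynomial.pow_comp, Polynomial.X_comp, Polynomial.mul_comp,
      Polynomial.C_comp, hfrob]
    rw [← Polynomial.C_pow, hct, Polynomial.C_mul]
    ring
  induction hd : f.natDegree using Nat.strong_induction_on generalizing f i with
  | _ d ih =>
    have hi0 : i ≠ 0 := fun h => hi (h ▸ dvd_zero _)
    rcases Nat.eq_zero_or_pos d with rfl | hd0
    · rw [Polynomial.eq_C_of_natDegree_eq_zero hd, Polynomial.coeff_C_of_ne_zero hi0]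
      exact dvd_zero _
    -- `f - f(0)` has the `q` roots `c • t`
    have heval : ∀ c : F, (f - Polynomial.C (f.eval 0)).eval (c • t) = 0 := fun c => by
      have h := congrArg (Polynomial.eval 0) (hf c)
      simp only [Polynomial.eval_comp, Polynomial.eval_add, Polynomial.eval_X, Polynomial.eval_C,
        zero_add] at h
      simp [h]
    have hdvd : N ∣ f - Polynomial.C (f.eval 0) := by
      rw [← Polynomial.modByMonic_eq_zero_iff_dvd hN]
      refine Polynomial.eq_zero_of_natDegree_lt_card_of_eval_eq_zero (ι := F) _
        (f := fun c => c • t) (fun a b h => ?_) (fun c => ?_) ?_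
      · have h' : (a - b) • t = 0 := by rw [sub_smul]; exact sub_eq_zero.2 h
        exact sub_eq_zero.1 ((smul_eq_zero.1 h').resolve_right ht)
      · have hNe : N.eval (c • t) = 0 := by simp [N, hct]
        rw [Polynomial.modByMonic_eq_sub_mul_div, Polynomial.eval_sub, heval, Polynomial.eval_mul,
          hNe, zero_mul, sub_zero]
      · exact hNd ▸ Polynomial.natDegree_modByMonic_lt _ hN (by
          intro h1
          have := congrArg Polynomial.natDegree h1
          rw [hNd, Polynomial.natDegree_one] at this
          omega)
    obtain ⟨g, hg⟩ := hdvd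
    have hfg : f = Polynomial.C (f.eval 0) + N * g := by rw [← hg]; ring
    have hg0 : g ≠ 0 := by
      rintro rfl
      rw [hfg, mul_zero, add_zero, Polynomial.natDegree_C] at hd
      omega
    have hgd : g.natDegree < d := by
      have h1 : (f - Polynomial.C (f.eval 0)).natDegree = d := by rw [Polynomial.natDegree_sub_C, hd]
      rw [hg, hN.natDegree_mul' hg0, hNd] at h1
      omega
    have hgc : ∀ c : F, g.comp (Polynomial.X + Polynomial.C (c • t)) = g := fun c => by
      have h := hf c
      conv_lhs at h => rw [hfg]
      rw [Polynomial.add_comp, Polynomial.C_comp, Polynomial.mul_comp, hNc] at h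
      conv_rhs at h => rw [hfg]
      exact mul_left_cancel₀ hN.ne_zero (add_left_cancel h)
    have hrec := fun i hi => ih _ hgd g hgc i hi rfl
    obtain ⟨j, rfl⟩ := Nat.exists_eq_succ_of_ne_zero hi0
    rw [hfg, Polynomial.coeff_add, Polynomial.coeff_C_of_ne_zero hi0, zero_add]
    simp only [N, sub_mul, Polynomial.coeff_sub, Polynomial.coeff_X_pow_mul', mul_assoc,
      Polynomial.coeff_C_mul, Polynomial.coeff_X_mul]
    refine dvd_sub ?_ ((dvd_pow_self t (by omega)).mul_right _)
    split_ifs with hle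
    · exact hrec _ fun h => hi ((Nat.dvd_sub_iff_left hle dvd_rfl).1 h)
    · exact dvd_zero _

omit [Fintype F] in
lemma X_pow_dvd_iff {p : Fin n} {k : ℕ} {f : MvPolynomial (Fin n) F} :
    MvPolynomial.X p ^ k ∣ f ↔ ∀ d : Fin n →₀ ℕ, d p < k → f.coeff d = 0 := by
  rw [MvPolynomial.X_pow_eq_monomial, MvPolynomial.monomial_one_dvd_iff_modMonomial_eq_zero]
  constructor
  · intro h d hd
    rw [← MvPolynomial.coeff_modMonomial_of_not_le (s := Finsupp.single p k) f, h,
      MvPolynomial.coeff_zero]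
    rw [Finsupp.single_le_iff]
    omega
  · intro h
    ext d
    rw [MvPolynomial.coeff_zero]
    by_cases hd : Finsupp.single p k ≤ d
    · exact MvPolynomial.coeff_modMonomial_of_le _ hd
    · rw [MvPolynomial.coeff_modMonomial_of_not_le _ hd]
      refine h d ?_
      rw [Finsupp.single_le_iff] at hd
      omega

omit [Fintype F] in
lemma X_dvd_iff {p : Fin n} {f : MvPolynomial (Fin n) F} :
    MvPolynomial.X p ∣ f ↔ ∀ d : Fin n →₀ ℕ, d p = 0 → f.coeff d = 0 := by
  rw [← pow_one (MvPolynomial.X p), X_pow_dvd_iff]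
  simp only [Nat.lt_one_iff]

variable (F) in
/-- A polynomial as a polynomial in the single variable `x_j`; its coefficients, which do not
involve `x_j`, are again taken in `F[x_1, …, x_n]`. -/
def isolateVar (j : Fin n) :
    MvPolynomial (Fin n) F →ₐ[F] Polynomial (MvPolynomial (Fin n) F) :=
  MvPolynomial.aeval fun l => if l = j then Polynomial.X else Polynomial.C (MvPolynomial.X l)

omit [Fintype F] in
lemma coeff_coeff_isolateVar (j : Fin n) (f : MvPolynomial (Fin n) F) (d : Fin n →₀ ℕ) :
    ((isolateVar F j f).coeff (d j)).coeff (d.erase j) = f.coeff d := by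
  induction f using MvPolynomial.induction_on' with
  | monomial e a =>
    have h : isolateVar F j (MvPolynomial.monomial e a)
        = Polynomial.C (MvPolynomial.monomial (e.erase j) a) * Polynomial.X ^ e j := by
      have h1 : MvPolynomial.monomial e a
          = MvPolynomial.monomial (e.erase j) a * MvPolynomial.X j ^ e j := by
        rw [MvPolynomial.X_pow_eq_monomial, MvPolynomial.monomial_mul, mul_one, add_comm,
          Finsupp.single_add_erase]
      rw [h1, map_mul, map_pow, isolateVar, MvPolynomial.aeval_X, if_pos rfl,
        MvPolynomial.aeval_monomial, MvPolynomial.monomial_eq, Polynomial.C_mul, Finsupp.prod,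
        Finsupp.prod, map_prod]
      refine congrArg (· * _) (congrArg (_ * ·) (Finset.prod_congr rfl fun l hl => ?_))
      have : l ≠ j := by rintro rfl; simp at hl
      rw [if_neg this, Polynomial.C_pow]
    rw [h, Polynomial.coeff_C_mul_X_pow]
    split_ifs with hj
    · rw [MvPolynomial.coeff_monomial, MvPolynomial.coeff_monomial]
      congr 1
      refine propext ⟨fun h1 => ?_, fun h1 => h1 ▸ rfl⟩
      rw [← Finsupp.single_add_erase j e, h1, ← hj, Finsupp.single_add_erase]
    · rw [MvPolynomial.coeff_zero, MvPolynomial.coeff_monomial, if_neg]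
      rintro rfl
      exact hj rfl
  | add f g hf hg => rw [map_add, Polynomial.coeff_add, MvPolynomial.coeff_add, hf, hg,
      MvPolynomial.coeff_add]

omit [Fintype F] in
lemma transvection_apply_self {j p : Fin n} (h : p ≠ j) (c : F) :
    (Pi.single j 1 + Pi.single p c : Fin n → F) j ≠ 0 := by
  simp [h.symm]

/-- The transvection `x_j ↦ x_j + c x_p`. -/
def transvection {j p : Fin n} (h : p ≠ j) (c : F) : GL (Fin n) F :=
  replaceCol j (Pi.single j 1 + Pi.single p c) (transvection_apply_self h c)

omit [Fintype F] in
lemma isolateVar_transvection {j p : Fin n} (h : p ≠ j) (c : F) (f : MvPolynomial (Fin n) F) :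
    isolateVar F j (actHom (transvection h c) f)
      = (isolateVar F j f).comp (Polynomial.X + Polynomial.C (c • MvPolynomial.X p)) := by
  have hc : (isolateVar F j).comp (actHom (transvection h c))
      = ((Polynomial.aeval (R := MvPolynomial (Fin n) F)
        (Polynomial.X + Polynomial.C (c • MvPolynomial.X p :
          MvPolynomial (Fin n) F))).restrictScalars F).comp (isolateVar F j) := by
    ext1 l
    have hp : lin (Pi.single p c) = c • (MvPolynomial.X p : MvPolynomial (Fin n) F) := by
      rw [← lin_single, ← map_smul, ← Pi.single_smul, smul_eq_mul, mul_one]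
    by_cases hl : l = j
    · subst hl
      rw [AlgHom.comp_apply, transvection, actHom_replaceCol_self, map_add, lin_single, hp]
      simp [isolateVar, h, Polynomial.smul_C]
    · rw [AlgHom.comp_apply, transvection, actHom_replaceCol_of_ne _ _ hl]
      simp [isolateVar, hl]
  exact DFunLike.congr_fun hc f

/-- In a polynomial invariant under the transvections `x_j ↦ x_j + c x_p`, the monomials without
`x_p` are monomials in `x_j ^ q` and the other variables. -/
lemma dvd_of_transvection {j p : Fin n} (h : p ≠ j) {f : MvPolynomial (Fin n) F}
    (hf : ∀ c : F, actHom (transvection h c) f = f) {d : Fin n →₀ ℕ} (hp : d p = 0)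
    (hd : f.coeff d ≠ 0) : q ∣ d j := by
  by_contra hq
  refine hd ?_
  rw [← coeff_coeff_isolateVar j]
  refine X_dvd_iff.1 (dvd_coeff_of_comp_eq (MvPolynomial.X_ne_zero p) _ (fun c => ?_) _ hq) _ ?_
  · rw [← isolateVar_transvection h, hf]
  · rw [Finsupp.erase_ne h, hp]

/-- Modulo `x_p`, a relation `f = ∑ x_j h_j` between polynomials in the `x_j ^ q` is trivial. -/
lemma X_dvd_of_eq_sum {p : Fin n} {T : Finset (Fin n)} (hpT : p ∉ T)
    {f g : MvPolynomial (Fin n) F} {h : Fin n → MvPolynomial (Fin n) F}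
    (hfh : f = MvPolynomial.X p * g + ∑ j ∈ T, MvPolynomial.X j * h j)
    (hf : ∀ j ∈ T, ∀ d : Fin n →₀ ℕ, d p = 0 → f.coeff d ≠ 0 → q ∣ d j)
    (hh : ∀ l ∈ T, ∀ j ∈ T, ∀ d : Fin n →₀ ℕ, d p = 0 → (h l).coeff d ≠ 0 → q ∣ d j) :
    MvPolynomial.X p ∣ f ∧ ∀ l ∈ T, MvPolynomial.X p ∣ h l := by
  have hq := one_lt_q (F := F)
  have hdvd : ∀ l ∈ T, MvPolynomial.X p ∣ h l := by
    intro l hl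
    rw [X_dvd_iff]
    intro d hd
    by_contra hne
    have hlp : l ≠ p := fun h => hpT (h ▸ hl)
    have h1 := hh l hl l hl d hd hne
    have h2 : ¬ q ∣ d l + 1 := fun h2 => by
      have := Nat.dvd_one.1 ((Nat.dvd_add_right h1).1 h2)
      omega
    -- compare the coefficients of `x_l x ^ d`
    let e := d + Finsupp.single l 1
    have hel : e l = d l + 1 := by simp [e]
    have hep : e p = 0 := by simp [e, hd, hlp]
    have h3 := congrArg (MvPolynomial.coeff e) hfh
    rw [MvPolynomial.coeff_add, MvPolynomial.coeff_sum, X_dvd_iff.1 (dvd_mul_right _ g) e hep,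
      zero_add, Finset.sum_eq_single_of_mem l hl] at h3
    · rw [mul_comm, MvPolynomial.coeff_mul_X] at h3
      refine hne (h3.symm.trans (not_not.1 fun h4 => h2 ?_))
      exact hel ▸ hf l hl e hep h4
    · intro j hj hjl
      rw [MvPolynomial.coeff_X_mul']
      split_ifs with hs
      · by_contra h4
        have h5 := hh j hj l hl (e - Finsupp.single j 1) (by simp [hep]) h4
        rw [Finsupp.tsub_apply, Finsupp.single_eq_of_ne (Ne.symm hjl), hel, tsub_zero] at h5
        exact h2 h5
      · rfl
  refine ⟨?_, hdvd⟩
  rw [hfh]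
  exact dvd_add (dvd_mul_right _ _) (Finset.dvd_sum fun j hj => (hdvd j hj).mul_left _)

omit [Fintype F] in
lemma coeff_dilation {p : Fin n} {c : F} (hc : (Pi.single p c : Fin n → F) p ≠ 0)
    (f : MvPolynomial (Fin n) F) (d : Fin n →₀ ℕ) :
    (actHom (replaceCol p (Pi.single p c) hc) f).coeff d = c ^ d p * f.coeff d := by
  induction f using MvPolynomial.induction_on' with
  | monomial e a =>
    have h : actHom (replaceCol p (Pi.single p c) hc) (MvPolynomial.monomial e a)
        = MvPolynomial.monomial e (c ^ e p * a) := by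
      have hX : ∀ l, actHom (replaceCol p (Pi.single p c) hc) (MvPolynomial.X l)
          = MvPolynomial.C (if l = p then c else 1) * MvPolynomial.X l := fun l => by
        by_cases hl : l = p
        · subst hl
          rw [actHom_replaceCol_self, if_pos rfl, lin_apply, Finset.sum_eq_single l]
          · simp
          · intro b _ hb; simp [hb]
          · simp
        · rw [actHom_replaceCol_of_ne _ _ hl, if_neg hl, MvPolynomial.C_1, one_mul]
      rw [MvPolynomial.monomial_eq, MvPolynomial.monomial_eq, map_mul, Finsupp.prod, map_prod]
      have hC : ∏ l ∈ e.support, MvPolynomial.C (if l = p then c else 1) ^ e l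
          = (MvPolynomial.C (c ^ e p) : MvPolynomial (Fin n) F) := by
        by_cases hp : p ∈ e.support
        · rw [Finset.prod_eq_single_of_mem p hp fun l _ hl => by simp [hl], if_pos rfl, MvPolynomial.C_pow]
        · rw [Finsupp.notMem_support_iff.1 hp, pow_zero, MvPolynomial.C_1]
          refine Finset.prod_eq_one fun l hl => ?_
          have hlp : l ≠ p := fun h' => hp (h' ▸ hl)
          rw [if_neg hlp, MvPolynomial.C_1, one_pow]
      simp only [map_pow, hX, mul_pow, Finset.prod_mul_distrib, hC]
      rw [← MvPolynomial.algebraMap_eq, AlgHom.commutes, ← mul_assoc, ← map_pow, ← map_mul, mul_comm a]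
    rw [h, MvPolynomial.coeff_monomial, MvPolynomial.coeff_monomial]
    split_ifs with he
    · rw [he]
    · rw [mul_zero]
  | add f g hf hg => rw [map_add, MvPolynomial.coeff_add, MvPolynomial.coeff_add, hf, hg, mul_add]

/-- The dilations of `x_p` force the exponents of `x_p` to be multiples of `q - 1`. -/
lemma X_pow_dvd_of_dilation {p : Fin n} {f : MvPolynomial (Fin n) F}
    (hf : ∀ (c : F) (hc : (Pi.single p c : Fin n → F) p ≠ 0),
      actHom (replaceCol p (Pi.single p c) hc) f = f)
    (hdvd : MvPolynomial.X p ∣ f) : MvPolynomial.X p ^ (q - 1) ∣ f := by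
  rw [X_pow_dvd_iff]
  intro d hd
  by_contra hne
  have h1 : q - 1 ∣ d p := by
    rw [← FiniteField.forall_pow_eq_one_iff F]
    intro x
    have hx : (Pi.single p (x : F) : Fin n → F) p ≠ 0 := by simp
    have h2 := coeff_dilation hx f d
    rw [hf] at h2
    exact Units.ext (by simpa using (mul_eq_right₀ hne).1 h2.symm)
  exact hne (X_dvd_iff.1 hdvd d (Nat.eq_zero_of_dvd_of_lt h1 hd))

end Exponents

/-! ### Divisibility of the values of invariant forms -/

section Divisibility

variable {F : Type*} [Field F] [Fintype F] {n : ℕ} {I : Composition n}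

local notation "q" => Fintype.card F

variable (F) in
/-- The rows of the coordinate functionals, in which the one of `x_p` is replaced by the row with
entries `x_j` for `j ≥ p`, and `0` for `j < p`. The transvections `x_j ↦ x_j + c x_p`, `j > p`,
commute with all of these rows, but not with the coordinate functional of `x_p`. The rows are a
basis after inversion of `x_p`. -/
def adaptedRow (p : Fin n) : Matrix (Fin n) (Fin n) (MvPolynomial (Fin n) F) :=
  Matrix.of fun l => if l = p then fun j => if p ≤ j then MvPolynomial.X j else 0
    else Pi.single l 1

omit [Fintype F] in
lemma adaptedRow_self (p : Fin n) :
    adaptedRow F p p = fun j => if p ≤ j then MvPolynomial.X j else 0 := if_pos rfl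

omit [Fintype F] in
lemma adaptedRow_of_ne {p l : Fin n} (h : l ≠ p) : adaptedRow F p l = Pi.single l 1 := if_neg h

omit [Fintype F] in
lemma transvection_mem_parabolic {p j : Fin n} (h : p < j) (c : F) :
    transvection h.ne c ∈ parabolic F I := by
  refine replaceCol_mem_parabolic fun i hi => ?_
  have h1 := lt_blockEnd I j
  have h2 : (p : ℕ) < j := h
  have hij : i ≠ j := by rintro rfl; omega
  have hip : i ≠ p := by rintro rfl; omega
  simp [hij, hip]

omit [Fintype F] in
lemma isEquivariantRow_adaptedRow {p j : Fin n} (h : p < j) (c : F) (l : Fin n) :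
    IsEquivariantRow (transvection h.ne c) (adaptedRow F p l) := by
  intro i
  have hcol : ∀ φ : Fin n → MvPolynomial (Fin n) F,
      rowMap φ (fun r => transvection h.ne c r i) = if i = j then φ j + c • φ p else φ i := by
    intro φ
    have h1 : (fun r => transvection h.ne c r i)
        = if i = j then Pi.single j 1 + Pi.single p c else Pi.single i 1 := by
      ext r
      change ((1 : Matrix (Fin n) (Fin n) F).updateCol j _) r i = _
      split_ifs with hi
      · subst hi; simp
      · rw [Matrix.updateCol_ne hi, Matrix.one_apply, Pi.single_apply]
    rw [h1]
    split_ifs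
    · rw [map_add, rowMap_single, ← mul_one c, ← smul_eq_mul, Pi.single_smul, map_smul,
        rowMap_single]
      simp
    · rw [rowMap_single]
  rw [hcol]
  by_cases hl : l = p
  · subst hl
    simp only [adaptedRow_self, le_refl, if_true, h.le]
    by_cases h1 : i = j
    · subst h1
      rw [if_pos h.le, if_pos rfl, transvection, actHom_replaceCol_self, map_add, lin_single,
        ← mul_one c, ← smul_eq_mul, Pi.single_smul, map_smul, lin_single]
      simp
    · rw [if_neg h1]
      split_ifs
      · rw [transvection, actHom_replaceCol_of_ne _ _ h1]
      · rw [map_zero]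
  · rw [adaptedRow_of_ne hl]
    have hp : (Pi.single l 1 : Fin n → MvPolynomial (Fin n) F) p = 0 := by
      rw [Pi.single_eq_of_ne (Ne.symm hl)]
    rw [hp, smul_zero, add_zero]
    have hi : (if i = j then (Pi.single l 1 : Fin n → MvPolynomial (Fin n) F) j
        else (Pi.single l 1 : Fin n → MvPolynomial (Fin n) F) i)
        = (Pi.single l 1 : Fin n → MvPolynomial (Fin n) F) i := by
      split_ifs with h1
      · rw [h1]
      · rfl
    rw [hi, Pi.single_apply]
    split_ifs <;> simp

variable {k : ℕ} {ω : MvPolynomial (Fin n) F ⊗[F] ExteriorAlgebra F (Fin n → F)}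

lemma dvd_of_coeff_formEval_adaptedRow (hω : ω ∈ parabolicInvariants F I) {p j : Fin n}
    (h : p < j) (σ : Fin k → Fin n) {d : Fin n →₀ ℕ} (hp : d p = 0)
    (hd : (formEval (fun i => adaptedRow F p (σ i)) ω).coeff d ≠ 0) : q ∣ d j := by
  refine dvd_of_transvection h.ne (fun c => ?_) hp hd
  rw [← formEval_symExtRep fun i => isEquivariantRow_adaptedRow h c (σ i)]
  congr 1
  exact hω ⟨_, transvection_mem_parabolic h c⟩

omit [Fintype F] in
variable (F) in
lemma adaptedRow_self_eq_sum (p : Fin n) :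
    adaptedRow F p p = (MvPolynomial.X p : MvPolynomial (Fin n) F) • Pi.single p 1
      + ∑ j ∈ Finset.univ.filter fun j => p < j,
        (MvPolynomial.X j : MvPolynomial (Fin n) F) • adaptedRow F p j := by
  ext1 l
  have h : ∀ j ∈ Finset.univ.filter fun j => p < j,
      ((MvPolynomial.X j : MvPolynomial (Fin n) F) • adaptedRow F p j) l
        = if j = l then MvPolynomial.X l else 0 := fun j hj => by
    rw [adaptedRow_of_ne (Finset.mem_filter.1 hj).2.ne', Pi.smul_apply, Pi.single_apply]
    by_cases hjl : j = l
    · subst hjl; simp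
    · simp [hjl, Ne.symm hjl]
  rw [Pi.add_apply, Finset.sum_apply, Finset.sum_congr rfl h, Finset.sum_ite_eq', adaptedRow_self,
    Pi.smul_apply, Pi.single_apply]
  rcases lt_trichotomy p l with hl | rfl | hl
  · simp [hl, hl.le, hl.ne']
  · simp
  · simp [hl.not_ge, hl.not_gt, hl.ne]

/-- The expansion of the adapted row of `x_p` is a relation between values on adapted rows, to
which `X_dvd_of_eq_sum` applies. -/
lemma X_dvd_formEval_adaptedRow (hω : ω ∈ parabolicInvariants F I) {p : Fin n}
    (σ : Fin k → Fin n) {i : Fin k} (hi : p ≤ σ i) :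
    MvPolynomial.X p ∣ formEval (fun i => adaptedRow F p (σ i)) ω := by
  let T : Finset (Fin n) := Finset.univ.filter fun j => p < j
  let β : Fin n → MvPolynomial (Fin n) F := fun l =>
    formEval (fun i' => adaptedRow F p (Function.update σ i l i')) ω
  have hβ : ∀ l, β l = formAlt k ω (Function.update (fun i' => adaptedRow F p (σ i')) i
      (adaptedRow F p l)) := fun l =>
    congrArg (fun θ => formEval θ ω) (Function.comp_update (adaptedRow F p) σ i l)
  have hsum : β p = MvPolynomial.X p * formAlt k ω
      (Function.update (fun i' => adaptedRow F p (σ i')) i (Pi.single p 1))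
      + ∑ j ∈ T, MvPolynomial.X j * β j := by
    simp only [hβ]
    rw [adaptedRow_self_eq_sum F p, AlternatingMap.map_update_add, AlternatingMap.map_update_smul,
      AlternatingMap.map_update_sum, smul_eq_mul]
    exact congrArg (_ + ·) (Finset.sum_congr rfl fun j _ => AlternatingMap.map_update_smul _ _ _ _ _)
  have hmain := X_dvd_of_eq_sum (by simp [T]) hsum
    (fun j hj d hp hd => dvd_of_coeff_formEval_adaptedRow hω (Finset.mem_filter.1 hj).2 _ hp hd)
    (fun l _ j hj d hp hd =>
      dvd_of_coeff_formEval_adaptedRow hω (Finset.mem_filter.1 hj).2 _ hp hd)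
  have hσ : β (σ i) = formEval (fun i => adaptedRow F p (σ i)) ω := by
    simp only [β, Function.update_eq_self]
  rw [← hσ]
  rcases hi.eq_or_lt with h | h
  · rw [← h]
    exact hmain.1
  · exact hmain.2 _ (Finset.mem_filter.2 ⟨Finset.mem_univ _, h⟩)

/-- No denominators occur in the expansion of `dualRow r` in the adapted rows, because the entry
of `dualRow r` at `p` is divisible by `x_p`. -/
lemma exists_dualRow_eq_sum (p r : Fin n) : ∃ u : Fin n → MvPolynomial (Fin n) F,
    dualRow F I r = ∑ l, u l • adaptedRow F p l ∧
      ((p : ℕ) ≤ blockStart I r → ∀ l < p, u l = 0) := by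
  obtain ⟨a, ha⟩ := X_dvd_dualRow (F := F) I r p
  refine ⟨fun l => if l = p then a else dualRow F I r l - a * adaptedRow F p p l, ?_, ?_⟩
  · have h : ∀ l, (if l = p then a else dualRow F I r l - a * adaptedRow F p p l)
        • adaptedRow F p l = (if l = p then a • adaptedRow F p p else 0)
          + (dualRow F I r l - a * adaptedRow F p p l) • Pi.single l 1 := by
      intro l
      split_ifs with hl
      · subst hl
        rw [ha, adaptedRow_self]
        simp [mul_comm]
      · rw [adaptedRow_of_ne hl, zero_add]
    rw [Finset.sum_congr rfl fun l _ => h l, Finset.sum_add_distrib, Finset.sum_ite_eq',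
      if_pos (Finset.mem_univ p), ← pi_eq_sum_univ' fun l =>
        dualRow F I r l - a * adaptedRow F p p l]
    ext1 j
    simp
  · intro hr l hl
    have hl' : (l : ℕ) < p := hl
    simp only [if_neg hl.ne, dualRow_eq_zero I (hl'.trans_le hr), adaptedRow_self,
      if_neg (not_le.2 hl), mul_zero, sub_zero]

lemma X_dvd_formEval_dualRows (hω : ω ∈ parabolicInvariants F I) {p b : Fin n}
    {B : Set.powersetCard (Fin n) k} (hb : b ∈ (B : Finset (Fin n)))
    (hp : (p : ℕ) ≤ blockStart I b) :
    MvPolynomial.X p ∣ formEval (dualRows F I B) ω := by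
  choose u hu hu0 using exists_dualRow_eq_sum (F := F) (I := I) p
  obtain ⟨i, rfl⟩ := exists_enum_eq hb
  have h : dualRows F I B = fun i => ∑ l, u (enum B i) l • adaptedRow F p l :=
    funext fun i => hu (enum B i)
  rw [← formAlt_apply, ← AlternatingMap.coe_multilinearMap, h, MultilinearMap.map_sum]
  refine Finset.dvd_sum fun σ _ => ?_
  rw [MultilinearMap.map_smul_univ, smul_eq_mul]
  rcases lt_or_ge (σ i) p with hσ | hσ
  · rw [Finset.prod_eq_zero (Finset.mem_univ i) (hu0 _ hp _ hσ), zero_mul]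
    exact dvd_zero _
  · exact (X_dvd_formEval_adaptedRow hω σ hσ).mul_left _

lemma X_pow_dvd_formEval_dualRows (hω : ω ∈ parabolicInvariants F I) {p b : Fin n}
    {B : Set.powersetCard (Fin n) k} (hb : b ∈ (B : Finset (Fin n)))
    (hp : (p : ℕ) ≤ blockStart I b) :
    MvPolynomial.X p ^ (q - 1) ∣ formEval (dualRows F I B) ω := by
  refine X_pow_dvd_of_dilation (fun c hc => ?_) (X_dvd_formEval_dualRows hω hb hp)
  refine formEval_dualRows_mem_symInvariants I hω B _ (replaceCol_mem_parabolic fun j hj => ?_)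
  rw [Pi.single_eq_of_ne]
  rintro rfl
  have := lt_blockEnd I j
  omega

/-- The parabolic subgroup moves the first variable of a block to the other linear forms. -/
lemma lin_pow_dvd_formEval_dualRows (hω : ω ∈ parabolicInvariants F I)
    (B : Set.powersetCard (Fin n) k) {r : Fin n} (hr : (r : ℕ) < topEnd I B)
    {v : Fin n → F} (hv : v ∈ flagSpace F n r) :
    lin (Pi.single r 1 - v) ^ (q - 1) ∣ formEval (dualRows F I B) ω := by
  obtain ⟨b, hb, hrb⟩ := (Finset.lt_sup_iff).1 hr
  have hpr := blockStart_le I r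
  let p : Fin n := ⟨blockStart I r, hpr.trans_lt r.2⟩
  rw [mem_flagSpace] at hv
  obtain ⟨g, hg, hgX, -⟩ := exists_parabolic_actHom_X (I := I) p (Pi.single r 1 - v) (by
      intro j hj
      have h1 : ¬ blockEnd I p ≤ r := fun h => by
        have h2 := (blockEnd_le_iff I).1 h
        have h3 : blockStart I r < blockEnd I p := lt_blockEnd I p
        omega
      have hjr : j ≠ r := by rintro rfl; exact h1 hj
      rw [Pi.sub_apply, Pi.single_eq_of_ne hjr, hv j (by omega), sub_zero])
    ⟨r, hpr, by simp [hv r le_rfl]⟩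
  rw [← formEval_dualRows_mem_symInvariants I hω B g hg, ← hgX, ← map_pow]
  exact map_dvd (actHom g) (X_pow_dvd_formEval_dualRows hω hb (blockStart_mono I hrb))

omit [Fintype F] in
lemma irreducible_lin {u : Fin n → F} (hu : u ≠ 0) : Irreducible (lin u) := by
  obtain ⟨j, hj⟩ := Function.ne_iff.1 hu
  have hu' : lin u ≠ 0 := fun h => hu (lin_injective (h.trans (map_zero lin).symm))
  refine MvPolynomial.irreducible_of_totalDegree_eq_one ((isHomogeneous_lin u).totalDegree hu')
    fun x hx => ?_
  have := hx (Finsupp.single j 1)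
  rw [coeff_lin] at this
  exact isUnit_of_dvd_unit this (Ne.isUnit hj)

omit [Fintype F] in
lemma exists_smul_eq_of_lin_dvd {u v : Fin n → F} (hu : u ≠ 0) (hv : v ≠ 0)
    (h : lin u ∣ lin v) : ∃ c : F, c • u = v := by
  obtain ⟨x, hx⟩ := (irreducible_lin hu).associated_of_dvd (irreducible_lin hv) h
  obtain ⟨c, -, hc⟩ := MvPolynomial.isUnit_iff_eq_C_of_isReduced.1 x.isUnit
  refine ⟨c, lin_injective ?_⟩
  rw [map_smul, ← hx, hc, MvPolynomial.smul_eq_C_mul, mul_comm]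

omit [Fintype F] in
lemma isRelPrime_lin_pow {r s : Fin n} {v w : Fin n → F} (hv : ∀ j, r ≤ j → v j = 0)
    (hw : ∀ j, s ≤ j → w j = 0) (hne : r ≠ s ∨ v ≠ w) (e : ℕ) :
    IsRelPrime (lin (Pi.single r (1 : F) - v) ^ e) (lin (Pi.single s (1 : F) - w) ^ e) := by
  have hr : (Pi.single r (1 : F) - v : Fin n → F) r = 1 := by simp [hv r le_rfl]
  have hs : (Pi.single s (1 : F) - w : Fin n → F) s = 1 := by simp [hw s le_rfl]
  have hr0 : (Pi.single r (1 : F) - v : Fin n → F) ≠ 0 := fun h => by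
    rw [h] at hr
    exact zero_ne_one hr
  have hs0 : (Pi.single s (1 : F) - w : Fin n → F) ≠ 0 := fun h => by
    rw [h] at hs
    exact zero_ne_one hs
  refine IsRelPrime.pow ((irreducible_lin hr0).isRelPrime_iff_not_dvd.2 fun h => ?_)
  obtain ⟨c, hc⟩ := exists_smul_eq_of_lin_dvd hr0 hs0 h
  have hc0 : c ≠ 0 := by rintro rfl; exact hs0 (by rw [← hc, zero_smul])
  have h1 := congrFun hc r
  have h2 := congrFun hc s
  rw [Pi.smul_apply, hr, smul_eq_mul, mul_one] at h1
  rw [Pi.smul_apply, hs, smul_eq_mul] at h2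
  rcases lt_trichotomy r s with hlt | rfl | hlt
  · rw [Pi.sub_apply, Pi.single_eq_of_ne hlt.ne', hv s hlt.le] at h2
    simp at h2
  · have hc1 : c = 1 := h1.trans hs
    rw [hc1, one_smul] at hc
    exact hne.elim (fun h => h rfl) fun h => h (sub_right_injective hc)
  · rw [Pi.sub_apply, Pi.single_eq_of_ne hlt.ne', hw r hlt.le, sub_zero] at h1
    exact hc0 h1

lemma mooreProd_eq_prod {m : ℕ} (hm : m ≤ n) : mooreProd F n m
    = ∏ x ∈ (Finset.univ : Finset (Fin m)).sigma fun r => flagSpace F n (r : ℕ),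
      lin (Pi.single (Fin.castLE hm x.1) (1 : F) - x.2) := by
  rw [Finset.prod_sigma, mooreProd, Finset.prod_range]
  refine Finset.prod_congr rfl fun r _ => ?_
  have h := flagMap_X_eq_prod (F := F) (Fin.castLE hm r)
  rw [← flagVar_val] at h
  exact h

/-- The linear forms that divide `mooreProd` are pairwise coprime. -/
lemma mooreProd_pow_dvd {m : ℕ} (hm : m ≤ n) {f : MvPolynomial (Fin n) F} (e : ℕ)
    (h : ∀ r : Fin n, (r : ℕ) < m → ∀ v ∈ flagSpace F n r,
      lin (Pi.single r (1 : F) - v) ^ e ∣ f) : mooreProd F n m ^ e ∣ f := by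
  rw [mooreProd_eq_prod hm, ← Finset.prod_pow]
  have hmem : ∀ x ∈ (Finset.univ : Finset (Fin m)).sigma fun r => flagSpace F n (r : ℕ),
      x.2 ∈ flagSpace F n (x.1 : ℕ) := fun x hx => (Finset.mem_sigma.1 hx).2
  refine Finset.prod_dvd_of_isRelPrime ?_ ?_
  · rintro ⟨r, v⟩ hx ⟨s, w⟩ hy hxy
    have hv := mem_flagSpace.1 (hmem ⟨r, v⟩ hx)
    have hw := mem_flagSpace.1 (hmem ⟨s, w⟩ hy)
    have hne : Fin.castLE hm r ≠ Fin.castLE hm s ∨ v ≠ w := by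
      by_contra hc
      push Not at hc
      obtain ⟨h1, rfl⟩ := hc
      obtain rfl := Fin.castLE_injective _ h1
      exact hxy rfl
    exact isRelPrime_lin_pow (r := Fin.castLE hm r) (s := Fin.castLE hm s) hv hw hne e
  · rintro ⟨r, v⟩ hx
    have hv : v ∈ flagSpace F n (Fin.castLE hm r : ℕ) := hmem ⟨r, v⟩ hx
    exact h (Fin.castLE hm r) r.2 v hv

lemma mooreProd_pow_dvd_formEval_dualRows (hω : ω ∈ parabolicInvariants F I)
    (B : Set.powersetCard (Fin n) k) :
    mooreProd F n (topEnd I B) ^ (q - 1) ∣ formEval (dualRows F I B) ω :=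
  mooreProd_pow_dvd (isBlockBoundary_topEnd I (B : Finset (Fin n))).1 _ fun _ hr _ hv =>
    lin_pow_dvd_formEval_dualRows hω B hr hv

end Divisibility

/-! ### The dimension of the space of invariant forms -/

section Dimension

variable {F : Type*} [Field F] [Fintype F] {n : ℕ} {I : Composition n}

local notation "q" => Fintype.card F

omit [Fintype F] in
lemma smul_mem_bidegree {a b k : ℕ} {h : MvPolynomial (Fin n) F} (hh : h.IsHomogeneous a)
    {ω : MvPolynomial (Fin n) F ⊗[F] ExteriorAlgebra F (Fin n → F)} (hω : ω ∈ bidegree F n b k) :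
    h • ω ∈ bidegree F n (a + b) k := by
  obtain ⟨ω, rfl⟩ := hω
  induction ω using TensorProduct.induction_on with
  | zero => simp
  | tmul s x =>
    refine ⟨⟨h * s, hh.mul s.2⟩ ⊗ₜ x, ?_⟩
    simp only [TensorProduct.map_tmul, Submodule.subtype_apply, TensorProduct.smul_tmul',
      smul_eq_mul]
  | add x y hx hy =>
    rw [map_add, smul_add]
    exact add_mem hx hy

lemma isHomogeneous_mooreProd_pow (m : ℕ) :
    (mooreProd F n m ^ (q - 1)).IsHomogeneous (q ^ m - 1) := by
  have h := (isHomogeneous_mooreProd (F := F) (n := n) m).pow (q - 1)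
  rwa [mul_comm, sub_one_mul_sum_range q m one_lt_q] at h

lemma exists_mem_shiftedPiece {i k : ℕ}
    {ω : MvPolynomial (Fin n) F ⊗[F] ExteriorAlgebra F (Fin n → F)}
    (hω : ω ∈ parabolicInvariants F I) (hωi : ω ∈ bidegree F n i k)
    (B : Set.powersetCard (Fin n) k) :
    ∃ h ∈ shiftedPiece (Subalgebra.toSubmodule (symInvariants F I)) i (formWeight I q B),
      formEval (dualRows F I B) ω = mooreProd F n (topEnd I B) ^ (q - 1) * h := by
  obtain ⟨h, hh⟩ := mooreProd_pow_dvd_formEval_dualRows hω B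
  refine ⟨h, ?_, hh⟩
  have hb := isBlockBoundary_topEnd I (B : Finset (Fin n))
  have hP : mooreProd F n (topEnd I B) ^ (q - 1) ≠ 0 := pow_ne_zero _ (mooreProd_ne_zero hb.1)
  have hinv : h ∈ symInvariants F I := fun g hg => by
    have h1 := formEval_dualRows_mem_symInvariants I hω B g hg
    rw [hh, map_mul, actHom_mooreProd_pow hb hg] at h1
    exact mul_left_cancel₀ hP h1
  have hw := formWeight_add I q one_lt_q (B : Finset (Fin n))
  have h2 := isHomogeneous_formEval_dualRows I hωi B
  have h3 := MvPolynomial.homogeneousComponent_of_mem h2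
    (m := i + ∑ b ∈ (B : Finset (Fin n)), q ^ (b : ℕ))
  rw [if_pos rfl] at h3
  rw [hh, homogeneousComponent_mul_of_isHomogeneous (isHomogeneous_mooreProd_pow _)] at h3
  split_ifs at h3 with hle
  · have hle' : formWeight I q B ≤ i := by omega
    have h4 := mul_left_cancel₀ hP h3
    rw [shiftedPiece_of_le hle']
    refine ⟨hinv, ?_⟩
    have hd : i + ∑ b ∈ (B : Finset (Fin n)), q ^ (b : ℕ) - (q ^ topEnd I B - 1)
        = i - formWeight I q B := by omega
    rw [hd] at h4
    rw [← h4]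
    exact MvPolynomial.homogeneousComponent_mem _ _
  · rw [(mul_eq_zero.1 h3.symm).resolve_left hP]
    exact zero_mem _

/-- The space of invariant forms of a given bidegree, through the expansion of invariant forms
in the forms `basisForm` with invariant coefficients. -/
lemma finrank_parabolicInvariants (i k : ℕ) :
    Module.finrank F ↥(parabolicInvariants F I ⊓ bidegree F n i k)
      = ∑ B : Set.powersetCard (Fin n) k, Module.finrank F
        (shiftedPiece (Subalgebra.toSubmodule (symInvariants F I)) i (formWeight I q B)) := by
  let Φ : (Set.powersetCard (Fin n) k → MvPolynomial (Fin n) F) →ₗ[F]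
      MvPolynomial (Fin n) F ⊗[F] ExteriorAlgebra F (Fin n → F) :=
    (Fintype.linearCombination (MvPolynomial (Fin n) F) (basisForm F I)).restrictScalars F
  have hΦ : ∀ e, Φ e = ∑ B, e B • basisForm F I B := fun _ => rfl
  have heval : ∀ e B, formEval (dualRows F I B) (Φ e)
      = e B * mooreProd F n (topEnd I B) ^ (q - 1) := fun e B => by
    simp only [hΦ, map_sum, map_smul, formEval_dualRows_basisForm, smul_eq_mul, mul_ite, mul_zero]
    rw [Finset.sum_ite_eq, if_pos (Finset.mem_univ B)]
  have hP : ∀ B : Set.powersetCard (Fin n) k, mooreProd F n (topEnd I B) ^ (q - 1) ≠ 0 := fun B =>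
    pow_ne_zero _ (mooreProd_ne_zero (isBlockBoundary_topEnd I (B : Finset (Fin n))).1)
  have hbi : ∀ e, (∀ B : Set.powersetCard (Fin n) k, e B ∈ shiftedPiece (Subalgebra.toSubmodule (symInvariants F I)) i
      (formWeight I q B)) → Φ e ∈ bidegree F n i k := fun e he => by
    rw [hΦ]
    refine sum_mem fun B _ => ?_
    have h := he B
    rcases le_or_gt (formWeight I q B) i with hle | hlt
    · rw [shiftedPiece_of_le hle] at h
      have h1 := smul_mem_bidegree h.2 (basisForm_mem_bidegree (F := F) I B)
      rwa [Nat.sub_add_cancel hle] at h1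
    · rw [shiftedPiece_of_lt hlt, Submodule.mem_bot] at h
      rw [h, zero_smul]
      exact zero_mem _
  have hP' : ∀ B : Set.powersetCard (Fin n) k,
      mooreProd F n (topEnd I B) ^ (q - 1) ∈ symInvariants F I := fun B g hg =>
    actHom_mooreProd_pow (isBlockBoundary_topEnd I (B : Finset (Fin n))) hg
  refine finrank_eq_sum_finrank_shiftedPiece (w := fun B : Set.powersetCard (Fin n) k => formWeight I q B) Φ ?_ ?_ ?_
  · intro e _ he
    ext1 B
    have h := heval e B
    rw [he, map_zero] at h
    exact (mul_eq_zero.1 h.symm).resolve_right (hP B)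
  · intro e he
    refine ⟨mem_parabolicInvariants_of_formEval I (hbi e he) fun B => ?_, hbi e he⟩
    rw [heval]
    exact mul_mem (shiftedPiece_le _ _ _ (he B)) (hP' B)
  · rintro ω ⟨hω, hωi⟩
    choose e he hee using exists_mem_shiftedPiece hω hωi
    refine ⟨e, he, (sub_eq_zero.1 (eq_zero_of_formEval_dualRows I
      (sub_mem hωi (hbi e he)) fun B => ?_)).symm⟩
    rw [map_sub, heval, hee, mul_comm, sub_self]

end Dimension

/-! ### Summation of the series -/

section Series

variable {n : ℕ}

/-- Power series in `t` as elements of `ℚ((t))((s))`. -/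
def seriesHom : PowerSeries ℚ →+* SeriesField :=
  (HahnSeries.C : LaurentSeries ℚ →+* SeriesField).comp (HahnSeries.ofPowerSeries ℤ ℚ)

lemma seriesHom_X : seriesHom PowerSeries.X = tVar := by
  rw [seriesHom, RingHom.comp_apply, HahnSeries.ofPowerSeries_X]
  rfl

lemma tVar_ne_zero : tVar ≠ 0 := by
  rw [tVar, Ne, map_eq_zero]
  exact HahnSeries.single_ne_zero one_ne_zero

lemma doubleSeries_sum {ι : Type*} [Fintype ι] (w : ι → ℕ) (f : ι → PowerSeries ℚ) :
    doubleSeries (fun i j => ∑ B, if w B = j then PowerSeries.coeff i (f B) else 0)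
      = ∑ B, sVar ^ w B * seriesHom (f B) := by
  have h1 : (PowerSeries.mk fun j => HahnSeries.ofPowerSeries ℤ ℚ (PowerSeries.mk fun i =>
      ∑ B, if w B = j then PowerSeries.coeff i (f B) else 0))
      = ∑ B, PowerSeries.X ^ w B * PowerSeries.C (HahnSeries.ofPowerSeries ℤ ℚ (f B)) := by
    ext1 j
    have h2 : (PowerSeries.mk fun i => ∑ B, if w B = j then PowerSeries.coeff i (f B) else 0)
        = ∑ B, if w B = j then f B else 0 := by
      ext1 i
      rw [PowerSeries.coeff_mk, map_sum]
      refine Finset.sum_congr rfl fun B _ => ?_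
      split_ifs <;> simp
    rw [PowerSeries.coeff_mk, h2, map_sum, map_sum]
    refine Finset.sum_congr rfl fun B _ => ?_
    rw [mul_comm, PowerSeries.coeff_C_mul, PowerSeries.coeff_X_pow, mul_ite, mul_one, mul_zero]
    simp only [eq_comm (a := j)]
    split_ifs <;> simp
  rw [doubleSeries, h1, map_sum]
  refine Finset.sum_congr rfl fun B _ => ?_
  rw [map_mul, map_pow, HahnSeries.ofPowerSeries_X, HahnSeries.ofPowerSeries_C]
  rfl

/-- The contribution `s ^ |B| t ^ (-∑ q ^ b)` of a set of positions. -/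
def mixedTerm (Q : ℕ) (B : Finset (Fin n)) : SeriesField :=
  ∏ b ∈ B, (sVar * tVar ^ (-((Q ^ (b : ℕ) : ℕ) : ℤ)))

lemma pow_mul_mixedTerm (Q : ℕ) (B : Finset (Fin n)) {w e : ℕ}
    (h : w + ∑ b ∈ B, Q ^ (b : ℕ) = e) :
    tVar ^ e * mixedTerm Q B = sVar ^ B.card * tVar ^ w := by
  have ht : ∀ a : ℕ, tVar ^ (-(a : ℤ)) = (tVar ^ a)⁻¹ := fun a =>
    (zpow_neg (α := SeriesField) tVar a).trans (congrArg _ (zpow_natCast tVar a))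
  have h1 : tVar ^ (∑ b ∈ B, Q ^ (b : ℕ)) ≠ 0 := pow_ne_zero _ tVar_ne_zero
  simp only [mixedTerm, ht, Finset.prod_mul_distrib, Finset.prod_const, Finset.prod_inv_distrib,
    Finset.prod_pow_eq_pow_sum]
  rw [← h, pow_add]
  field_simp

lemma mixedProd_eq_sum (Q : ℕ) {m : ℕ} (hm : m ≤ n) :
    mixedProd Q m = ∑ B : Finset (Fin n), if ∀ b ∈ B, (b : ℕ) < m then mixedTerm Q B else 0 := by
  have h1 : mixedProd Q m = ∏ b ∈ Finset.univ.filter fun b : Fin n => (b : ℕ) < m,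
      (1 + sVar * tVar ^ (-((Q ^ (b : ℕ) : ℕ) : ℤ))) := by
    rw [mixedProd]
    refine (Finset.prod_bij (fun (b : Fin n) _ => (b : ℕ) + 1) ?_ ?_ ?_ ?_).symm
    · intro b hb
      have := (Finset.mem_filter.1 hb).2
      rw [Finset.mem_Icc]
      omega
    · intro a _ b _ hab
      exact Fin.ext (by omega)
    · intro j hj
      rw [Finset.mem_Icc] at hj
      exact ⟨⟨j - 1, by omega⟩, by simp only [Finset.mem_filter, Finset.mem_univ, true_and]; omega,
        by simp only; omega⟩
    · intro b _
      rw [Nat.add_sub_cancel]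
  rw [h1, Finset.prod_one_add, ← Finset.sum_filter]
  refine Finset.sum_congr ?_ fun _ _ => rfl
  ext B
  simp [Finset.subset_iff]

lemma sum_telescope {R : Type*} [AddCommGroup R] {m : ℕ → ℕ} (hm : Monotone m) (e : ℕ → R)
    {i l : ℕ} (hil : i ≤ l) :
    (∑ j ∈ Finset.range l, if m i ≤ m j then e (m j) - e (m (j + 1)) else 0) + e (m l)
      = e (m i) := by
  induction l, hil using Nat.le_induction with
  | base =>
    rw [Finset.sum_eq_zero, zero_add]
    intro j hj
    split_ifs with h
    · have hj' := Finset.mem_range.1 hj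
      rw [le_antisymm (hm hj'.le) h, le_antisymm (hm hj') (h.trans (hm j.le_succ)), sub_self]
    · rfl
  | succ l hl ih =>
    rw [Finset.sum_range_succ, if_pos (hm hl), ← ih]
    abel

lemma exists_sizeUpTo_eq_topEnd (I : Composition n) (B : Finset (Fin n)) :
    ∃ i ≤ I.length, I.sizeUpTo i = topEnd I B := by
  rcases B.eq_empty_or_nonempty with rfl | hB
  · exact ⟨0, Nat.zero_le _, I.sizeUpTo_zero⟩
  · obtain ⟨b, -, hb⟩ := Finset.exists_mem_eq_sup B hB (blockEnd I)
    exact ⟨_, (I.index b).2, hb.symm⟩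

lemma forall_lt_sizeUpTo_iff (I : Composition n) (B : Finset (Fin n)) (i : ℕ) :
    (∀ b ∈ B, (b : ℕ) < I.sizeUpTo i) ↔ topEnd I B ≤ I.sizeUpTo i := by
  refine ⟨fun h => Finset.sup_le fun b hb => I.monotone_sizeUpTo ?_,
    fun h b hb => (lt_topEnd I hb).trans_le h⟩
  by_contra hc
  have h1 := I.monotone_sizeUpTo (Nat.le_of_lt_succ (not_le.1 hc))
  have h2 := blockStart_le I b
  have h3 := h b hb
  unfold blockStart at h2
  omega

/-- Summation by parts: the numerator is the sum over all `B` of `t ^ (q ^ m - 1)` times the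
term of `B`, where `m` is the end of the last block that meets `B`. -/
lemma numerator_eq_sum (Q : ℕ) (hn : 1 ≤ n) (I : Composition n) :
    1 - tVar ^ (Q ^ I.sizeUpTo 1 - 1)
        + ∑ i ∈ Finset.Icc 1 (I.length - 1),
            (tVar ^ (Q ^ I.sizeUpTo i - 1) - tVar ^ (Q ^ I.sizeUpTo (i + 1) - 1))
              * mixedProd Q (I.sizeUpTo i)
        + tVar ^ (Q ^ n - 1) * mixedProd Q n
      = ∑ B : Finset (Fin n), tVar ^ (Q ^ topEnd I B - 1) * mixedTerm Q B := by
  have hl : 0 < I.length := I.length_pos_iff.2 hn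
  let e : ℕ → SeriesField := fun m => tVar ^ (Q ^ m - 1)
  have h1 : 1 - tVar ^ (Q ^ I.sizeUpTo 1 - 1)
        + ∑ i ∈ Finset.Icc 1 (I.length - 1),
            (tVar ^ (Q ^ I.sizeUpTo i - 1) - tVar ^ (Q ^ I.sizeUpTo (i + 1) - 1))
              * mixedProd Q (I.sizeUpTo i)
      = ∑ i ∈ Finset.range I.length, (e (I.sizeUpTo i) - e (I.sizeUpTo (i + 1)))
          * mixedProd Q (I.sizeUpTo i) := by
    have h2 : Finset.range I.length = insert 0 (Finset.Icc 1 (I.length - 1)) := by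
      ext i
      simp only [Finset.mem_range, Finset.mem_insert, Finset.mem_Icc]
      omega
    rw [h2, Finset.sum_insert (by simp)]
    simp [e, mixedProd]
  rw [h1, mixedProd_eq_sum Q le_rfl]
  simp only [mixedProd_eq_sum Q (I.sizeUpTo_le _), forall_lt_sizeUpTo_iff, Finset.mul_sum]
  rw [Finset.sum_comm, ← Finset.sum_add_distrib]
  refine Finset.sum_congr rfl fun B _ => ?_
  obtain ⟨i, hi, hiB⟩ := exists_sizeUpTo_eq_topEnd I B
  rw [if_pos fun b _ => b.2, ← hiB]
  have h3 := sum_telescope I.monotone_sizeUpTo e hi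
  rw [I.sizeUpTo_length] at h3
  change _ = e (I.sizeUpTo i) * _
  rw [← h3, add_mul, Finset.sum_mul]
  refine congrArg (· + _) (Finset.sum_congr rfl fun j _ => ?_)
  split_ifs <;> simp

lemma prod_blocks_eq_prod {A : Type*} [CommMonoid A] (I : Composition n) (f : ℕ → ℕ → A) :
    ∏ i : Fin I.length, ∏ j ∈ Finset.Icc 1 (I.blocksFun i),
        f (I.sizeUpTo (i + 1)) (I.sizeUpTo (i + 1) - j)
      = ∏ k : Fin n, f (blockEnd I k) k := by
  rw [← Composition.prod_prod_apply_embedding (fun k => f (blockEnd I k) k) I]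
  refine Finset.prod_congr rfl fun i _ => ?_
  have hs := I.sizeUpTo_succ' i
  refine (Finset.prod_bij (fun (j : Fin (I.blocksFun i)) _ => I.blocksFun i - j) ?_ ?_ ?_ ?_).symm
  · intro j _
    have := j.2
    rw [Finset.mem_Icc]
    omega
  · intro a _ b _ hab
    have := a.2
    have := b.2
    exact Fin.ext (by omega)
  · intro j hj
    rw [Finset.mem_Icc] at hj
    exact ⟨⟨I.blocksFun i - j, by omega⟩, Finset.mem_univ _, by simp only; omega⟩
  · intro j _
    have := j.2
    rw [blockEnd, I.index_embedding, I.coe_embedding]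
    congr 1
    omega

variable {F : Type*} [Field F] [Fintype F]

local notation "q" => Fintype.card F

lemma hilbertSeries_eq_sum (I : Composition n) : hilbertSeries F I
    = (∑ B : Finset (Fin n), tVar ^ (q ^ topEnd I B - 1) * mixedTerm q B)
      * seriesHom (gradedSeries (Subalgebra.toSubmodule (symInvariants F I))) := by
  have h : ∀ i k : ℕ, (Module.finrank F ↥(parabolicInvariants F I ⊓ bidegree F n i k) : ℚ)
      = ∑ B : Finset (Fin n), if B.card = k then PowerSeries.coeff i (PowerSeries.X ^
        formWeight I q B * gradedSeries (Subalgebra.toSubmodule (symInvariants F I))) else 0 := by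
    intro i k
    rw [finrank_parabolicInvariants, Nat.cast_sum, ← Finset.sum_filter]
    simp only [finrank_shiftedPiece]
    refine (Finset.sum_subtype _ (fun B => ?_) fun B : Finset (Fin n) => PowerSeries.coeff i
      (PowerSeries.X ^ formWeight I q B *
        gradedSeries (Subalgebra.toSubmodule (symInvariants F I)))).symm
    simp [Set.powersetCard]
  rw [hilbertSeries]
  simp only [h]
  rw [doubleSeries_sum, Finset.sum_mul]
  refine Finset.sum_congr rfl fun B _ => ?_
  rw [pow_mul_mixedTerm q B (formWeight_add I q one_lt_q B), map_mul, map_pow, seriesHom_X,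
    mul_assoc]

lemma mul_eq_div_of_mul_eq_one {K : Type*} [Field K] {a b c : K} (h : b * c = 1) :
    a * b = a / c := by
  rw [eq_div_iff (right_ne_zero_of_mul_eq_one h), mul_assoc, h, mul_one]

lemma seriesHom_gradedSeries_mul_prod (I : Composition n) :
    seriesHom (gradedSeries (Subalgebra.toSubmodule (symInvariants F I)))
      * ∏ k : Fin n, (1 - tVar ^ (q ^ blockEnd I k - q ^ (k : ℕ))) = 1 := by
  have h := congrArg seriesHom (gradedSeries_symInvariants_mul_prod (F := F) (I := I))
  simpa only [map_mul, map_prod, map_sub, map_one, map_pow, seriesHom_X] using h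

end Series

end DicksonMui

end

theorem theorem3p3 (F : Type*) [Field F] [Fintype F] (q : ℕ) (hq : Fintype.card F = q)
    (n : ℕ) (hn : 1 ≤ n) (I : Composition n) :
    DicksonMui.hilbertSeries F I =
      (1 - DicksonMui.tVar ^ (q ^ I.sizeUpTo 1 - 1)
        + ∑ i ∈ Finset.Icc 1 (I.length - 1),
            (DicksonMui.tVar ^ (q ^ I.sizeUpTo i - 1)
              - DicksonMui.tVar ^ (q ^ I.sizeUpTo (i + 1) - 1))
              * DicksonMui.mixedProd q (I.sizeUpTo i)
        + DicksonMui.tVar ^ (q ^ n - 1) * DicksonMui.mixedProd q n)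
      / ∏ i : Fin I.length, ∏ j ∈ Finset.Icc 1 (I.blocksFun i),
          (1 - DicksonMui.tVar
            ^ (q ^ I.sizeUpTo (i + 1) - q ^ (I.sizeUpTo (i + 1) - j))) := by
  subst hq
  have h := DicksonMui.seriesHom_gradedSeries_mul_prod (F := F) I
  rw [DicksonMui.numerator_eq_sum _ hn,
    DicksonMui.prod_blocks_eq_prod I fun a b =>
      1 - DicksonMui.tVar ^ (Fintype.card F ^ a - Fintype.card F ^ b),
    DicksonMui.hilbertSeries_eq_sum]
  exact DicksonMui.mul_eq_div_of_mul_eq_one (K := DicksonMui.SeriesField) h
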